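/- **Theorem 1.** Let $X$ be a real random variable with mean $\mu$ and variance $\sigma^2$, $0<\sigma<\infty$, such that $\mathbb E|X-\mu|^{1+\delta}<\infty$ for some $1\le\delta\le 2$. Let $X_1,\dots,X_N$ be independent copies of $X$ (no outliers), and let $\{1,\dots,N\}=G_1\cup\dots\cup G_k$ be a partition into $k\ge 1$ disjoint blocks of equal cardinality $n=N/k\ge 2$. Put $$\bar\mu_j=\frac1n\sum_{i\in G_j}X_i,\qquad \widehat\sigma_j=\Bigl(\frac1n\sum_{i\in G_j}(X_i-\bar\mu_j)^2\Bigr)^{1/2},\qquad \widehat\mu_{N,p}=\sum_{j=1}^k\frac{\widehat\sigma_j^{-p}}{\sum_{i=1}^k\widehat\sigma_i^{-p}}\,\bar\mu_j ,$$ for real $p\ge1$, and let $$\mathcal E_p=\Bigl\{\Bigl(\frac1k\sum_{j=1}^k\widehat\sigma_j^{-p}\Bigr)^{-1}\le(4\sigma)^p\Bigr\}\quad(1/0=\infty,\ 1/\infty=0),$$ $$\zeta(X)=\inf\bigl\{a>0:\ \mathbb E\bigl(|X-\mu|^2\mathbf 1\{|X-\mu|\le\sigma a\}\bigr)\ge\sigma^2/2\bigr\}.$$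 There are constants $C_p>0$ depending only on $p$ and $c>0$ depending only on $\zeta(X)$, and a function $\phi(\delta,n)$, depending only on $\delta$, $n$ and the distribution of $X$, with $$\phi(\delta,n)=o(n^{-\delta/2})\ \text{ if }\delta<2,\qquad \phi(\delta,n)=O(n^{-1})\ \text{ if }\delta=2,\qquad\text{as }n\to\infty,$$ such that for all $p\ge1$, all such $N,k,n$ and partitions, and all $s\ge0$, with probability at least $1-2e^{-s}-ke^{-cn}$ the following holds: if the event $\mathcal E_p$ occurs, then all $\widehat\sigma_j$ are positive (so that $\widehat\mu_{N,p}$ is well defined) and $$|\widehat\mu_{N,p}-\mu|\le C_p\,\sigma\left(\sqrt{\frac{s+1}{N}}+\phi(\delta,n)\right).$$ -/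

import Mathlib

open MeasureTheory ProbabilityTheory Filter Asymptotics
open scoped ENNReal

namespace BlockMeans

noncomputable section

/-- The mean `μ` of a law `P` on the real line. -/
def mean (P : Measure ℝ) : ℝ := ∫ x, x ∂P

/-- The standard deviation `σ` of a law `P` on the real line. -/
def sd (P : Measure ℝ) : ℝ := √(Var[fun x : ℝ => x; P])

/-- `ζ(X) = inf {a > 0 : E (|X - μ|² 1{|X - μ| ≤ σ a}) ≥ σ² / 2}` for `X` with law `P`. -/
def zeta (P : Measure ℝ) : ℝ :=
  sInf {a : ℝ | 0 < a ∧
    sd P ^ 2 / 2 ≤ ∫ x in {x : ℝ | |x - mean P| ≤ sd P * a}, |x - mean P| ^ 2 ∂P}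

/-- `G 0, …, G (k - 1)` partition the index set of the sample into blocks of cardinality `n`. -/
structure IsBlockPartition {N k : ℕ} (n : ℕ) (G : Fin k → Finset (Fin N)) : Prop where
  disjoint : ∀ i j, i ≠ j → Disjoint (G i) (G j)
  cover : ∀ i, ∃ j, i ∈ G j
  card : ∀ j, (G j).card = n

/-- The sample mean of the data `x` over the block `B`. -/
def blockMean {N : ℕ} (x : Fin N → ℝ) (B : Finset (Fin N)) : ℝ :=
  (∑ i ∈ B, x i) / (B.card : ℝ)

/-- The sample standard deviation of the data `x` over the block `B`, normalised by `|B|`. -/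
def blockSd {N : ℕ} (x : Fin N → ℝ) (B : Finset (Fin N)) : ℝ :=
  √((∑ i ∈ B, (x i - blockMean x B) ^ 2) / (B.card : ℝ))

/-- The weight of block `j`: `σ̂_j ^ (-p)` normalised so that the weights sum to one.
Meaningful when all block standard deviations are positive. -/
def weight {N k : ℕ} (p : ℝ) (G : Fin k → Finset (Fin N)) (x : Fin N → ℝ) (j : Fin k) : ℝ :=
  (1 / blockSd x (G j) ^ p) / ∑ i, 1 / blockSd x (G i) ^ p

/-- The weighted block-means estimator. -/
def estimator {N k : ℕ} (p : ℝ) (G : Fin k → Finset (Fin N)) (x : Fin N → ℝ) : ℝ :=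
  ∑ j, weight p G x j * blockMean x (G j)

/-- The harmonic mean of `σ̂_1 ^ p, …, σ̂_k ^ p`. It is computed in `[0, ∞]`, where `1 / 0 = ∞` and
`1 / ∞ = 0`, so it vanishes as soon as one of the block standard deviations does. -/
def harmonicMean {N k : ℕ} (p : ℝ) (G : Fin k → Finset (Fin N)) (x : Fin N → ℝ) : ℝ≥0∞ :=
  ((k : ℝ≥0∞)⁻¹ * ∑ j, (ENNReal.ofReal (blockSd x (G j) ^ p))⁻¹)⁻¹

/-- The data `x` belong to the harmonic-mean event: the harmonic mean of the
`σ̂_j ^ p` is at most `(4 σ) ^ p`. -/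
def HarmonicMeanEvent {N k : ℕ} (σ p : ℝ) (G : Fin k → Finset (Fin N)) (x : Fin N → ℝ) : Prop :=
  harmonicMean p G x ≤ ENNReal.ofReal ((4 * σ) ^ p)

end

end BlockMeans

/-! After standardising, block `j` becomes a vector with sample mean `m_j` and standard deviation
`s_j`, and the error is `σ (∑ m_j / s_j ^ p) / ∑ 1 / s_j ^ p`. On the harmonic-mean event the
denominator is at least `k / 4 ^ p` (`natCast_le_of_harmonicMeanEvent`), so it suffices to bound a
sum of `k` independent copies of `m / s ^ p`. This needs tails, a bias bound, and a way to keep `s`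
away from zero.

Non-degeneracy. A block is good if `s ≥ 1 / 11` and `|m| ≤ 26 s`. Splitting a block into `⌊n / 2⌋`
disjoint pairs, the truncated squared differences are independent, bounded and of mean at least `1 /
5`, so Chernoff bounds make all `k` blocks good outside probability `k e ^ (-c n)`, with `c`
depending only on the truncation level, hence only on `ζ` (`exists_rate_not_isGood`).

Fluctuations. On good blocks, `m / s ^ p` is dominated by a self-normalised sum. Two moments suffice
for `E exp (t S - t² V) ≤ exp (n t²)`, where `S = ∑ x_i` and `V = ∑ x_i²`; integrating over `t`
bounds `E exp (S² / (8 (V + 2 n)))` by a universal constant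
(`IsStandard.integral_exp_selfNormalised`). So `score` is sub-Gaussian with variance proxy of order
`1 / n`, and the sum over blocks deviates by order `k √(s / N)`, `s` now being the confidence
parameter.

Bias. By linearity it reduces to `E [x_i w(v)]`, with `w` a bounded Lipschitz function of the sample
variance `v`. Setting `x_i` to zero inside `v` makes the factors independent and the expectation
zero; the price is `E |x| min(1, x² / n) + 2 / n` (`IsStandard.abs_integral_mul_truncWeight_le`).
Bad blocks add `e ^ (-c n / 2)` by Cauchy-Schwarz. The `1 + δ` moment makes the total `o(n ^ (-δ /
2))`, or `O(1 / n)` when `δ = 2`. -/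

namespace BlockMeans

/-! ### Product measures -/

section ProductMeasures

variable {ι κ : Type*} [Fintype ι] [Fintype κ]

/-- Selecting coordinates along an injection preserves products of a single law. -/
lemma measurePreserving_pi_comp_injective (Q : Measure ℝ) [IsProbabilityMeasure Q] {e : κ → ι}
    (he : Function.Injective e) :
    MeasurePreserving (fun (x : ι → ℝ) i => x (e i)) (Measure.pi fun _ => Q)
      (Measure.pi fun _ => Q) := by
  refine ⟨by fun_prop, ?_⟩
  have h := Measure.map_infinitePi_infinitePi_of_inj (P := fun _ : ι => Q) he
  simpa only [Measure.infinitePi_eq_pi] using h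

/-- Disjoint pairs of coordinates of an independent sample form an independent sample. -/
lemma measurePreserving_pairs (Q : Measure ℝ) [IsProbabilityMeasure Q] {e : κ ⊕ κ → ι}
    (he : Function.Injective e) :
    MeasurePreserving (fun (x : ι → ℝ) i => (x (e (.inl i)), x (e (.inr i))))
      (Measure.pi fun _ => Q) (Measure.pi fun _ => Q.prod Q) :=
  ((measurePreserving_arrowProdEquivProdArrow ℝ ℝ κ (fun _ => Q) (fun _ => Q)).symm.comp
    (measurePreserving_sumPiEquivProdPi (fun _ : κ ⊕ κ => Q))).comp
    (measurePreserving_pi_comp_injective Q he)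

lemma integral_prod_pairs (Q : Measure ℝ) [IsProbabilityMeasure Q] {e : κ ⊕ κ → ι}
    (he : Function.Injective e) {f : ℝ × ℝ → ℝ} (hf : Measurable f) :
    ∫ x : ι → ℝ, ∏ i, f (x (e (.inl i)), x (e (.inr i))) ∂(Measure.pi fun _ => Q) =
      (∫ z, f z ∂(Q.prod Q)) ^ Fintype.card κ := by
  have h := measurePreserving_pairs Q he
  rw [← integral_fintype_prod_eq_pow (ι := κ) f, ← h.map_eq, integral_map h.measurable.aemeasurable]
  exact (by fun_prop : Measurable fun y : κ → ℝ × ℝ => ∏ i, f (y i)).aestronglyMeasurable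

/-- The blocks of an independent sample, as random vectors. -/
lemma hasLaw_blocks {Ω : Type*} [MeasurableSpace Ω] {Pr : Measure Ω} {Q : Measure ℝ}
    [IsProbabilityMeasure Q] {Z : ι × κ → Ω → ℝ} (hZ : ∀ i, HasLaw (Z i) Q Pr)
    (hind : iIndepFun Z Pr) :
    HasLaw (fun ω i j => Z (i, j) ω) (Measure.pi fun _ : ι => Measure.pi fun _ : κ => Q) Pr := by
  have h := hind.hasLaw_pi hZ
  have hc := Measure.infinitePi_map_curry (fun (_ : ι) (_ : κ) => Q)
  simp only [Measure.infinitePi_eq_pi] at hc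
  refine ⟨by fun_prop, ?_⟩
  rw [← hc, ← h.map_eq, AEMeasurable.map_map_of_aemeasurable (by fun_prop) h.aemeasurable]
  rfl

end ProductMeasures

/-! ### Block statistics of a real vector -/

section Statistics

variable {n : ℕ}

/-- The sample mean of a vector. -/
noncomputable def vecMean (x : Fin n → ℝ) : ℝ := (∑ i, x i) / n

/-- The sample variance of a vector, normalised by its length. -/
noncomputable def vecVar (x : Fin n → ℝ) : ℝ := (∑ i, (x i - vecMean x) ^ 2) / n

/-- The sample standard deviation of a vector. -/
noncomputable def vecSd (x : Fin n → ℝ) : ℝ := √(vecVar x)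

@[fun_prop]
lemma measurable_vecMean : Measurable (vecMean (n := n)) := by
  unfold vecMean; fun_prop

@[fun_prop]
lemma measurable_vecVar : Measurable (vecVar (n := n)) := by
  unfold vecVar; fun_prop

@[fun_prop]
lemma measurable_vecSd : Measurable (vecSd (n := n)) := by
  unfold vecSd; fun_prop

lemma vecVar_nonneg (x : Fin n → ℝ) : 0 ≤ vecVar x := by unfold vecVar; positivity

lemma vecSd_nonneg (x : Fin n → ℝ) : 0 ≤ vecSd x := Real.sqrt_nonneg _

lemma sq_vecSd (x : Fin n → ℝ) : vecSd x ^ 2 = vecVar x := Real.sq_sqrt (vecVar_nonneg x)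

lemma sum_eq_mul_vecMean (hn : n ≠ 0) (x : Fin n → ℝ) : ∑ i, x i = n * vecMean x := by
  unfold vecMean; field_simp

lemma sum_sq_sub_vecMean (hn : n ≠ 0) (x : Fin n → ℝ) :
    ∑ i, (x i - vecMean x) ^ 2 = n * vecVar x := by
  unfold vecVar; field_simp

lemma sum_sq_eq (hn : n ≠ 0) (x : Fin n → ℝ) :
    ∑ i, x i ^ 2 = n * vecVar x + n * vecMean x ^ 2 := by
  rw [← sum_sq_sub_vecMean hn]
  have h : ∀ i, (x i - vecMean x) ^ 2 = x i ^ 2 - 2 * vecMean x * x i + vecMean x ^ 2 := by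
    intro i; ring
  simp only [h, Finset.sum_add_distrib, Finset.sum_sub_distrib, ← Finset.mul_sum,
    Finset.sum_const, Finset.card_univ, Fintype.card_fin, nsmul_eq_mul]
  rw [sum_eq_mul_vecMean hn x]
  ring

variable {κ : Type*} [Fintype κ]

/-- The squared differences over disjoint pairs are controlled by the sample variance. -/
lemma sum_pairs_sq_sub_le (hn : n ≠ 0) {e : κ ⊕ κ → Fin n} (he : Function.Injective e)
    (x : Fin n → ℝ) :
    ∑ i, (x (e (.inl i)) - x (e (.inr i))) ^ 2 ≤ 2 * (n * vecVar x) := by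
  classical
  rw [← sum_sq_sub_vecMean hn]
  have h1 : ∑ i, (x (e i) - vecMean x) ^ 2 ≤ ∑ i, (x i - vecMean x) ^ 2 := by
    rw [← Finset.sum_image (s := Finset.univ) (f := fun i => (x i - vecMean x) ^ 2)
      (fun a _ b _ h => he h)]
    exact Finset.sum_le_sum_of_subset_of_nonneg (Finset.subset_univ _)
      fun _ _ _ => sq_nonneg _
  rw [Fintype.sum_sum_type, ← Finset.sum_add_distrib] at h1
  have h2 : ∑ i, (x (e (.inl i)) - x (e (.inr i))) ^ 2 ≤
      2 * ∑ i, ((x (e (.inl i)) - vecMean x) ^ 2 + (x (e (.inr i)) - vecMean x) ^ 2) := by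
    rw [Finset.mul_sum]
    refine Finset.sum_le_sum fun i _ => ?_
    nlinarith [sq_nonneg (x (e (.inl i)) + x (e (.inr i)) - 2 * vecMean x)]
  linarith

/-- If a quarter of the selected coordinates is bounded by `2`, the sample mean is controlled by
the sample variance. -/
lemma abs_vecMean_le {m : ℕ} (hn : n ≠ 0) (hm : 0 < m) (hnm : n ≤ 3 * m) {e : Fin m → Fin n}
    (he : Function.Injective e) (x : Fin n → ℝ)
    (h : (m : ℝ) / 4 ≤ ∑ i, Set.indicator {y : ℝ | |y| ≤ 2} 1 (x (e i))) :
    |vecMean x| ≤ 2 + 4 * vecSd x := by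
  classical
  by_contra! hlt
  have hs := vecSd_nonneg x
  have hm' : (0 : ℝ) < m := by exact_mod_cast hm
  -- If the bound failed, every coordinate in `[-2, 2]` would be farther than `4 * vecSd x` from the
  -- mean. A number `m / 4` of them would contribute more than `4 m (vecSd x)²`, while only `n
  -- (vecSd x)² ≤ 3 m (vecSd x)²` is available.
  have h1 : ∀ i, Set.indicator {y : ℝ | |y| ≤ 2} 1 (x (e i)) *
      (4 * vecSd x + (|vecMean x| - 2 - 4 * vecSd x)) ^ 2 ≤ (x (e i) - vecMean x) ^ 2 := by
    intro i
    by_cases hi : |x (e i)| ≤ 2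
    · rw [Set.indicator_of_mem (by exact hi), Pi.one_apply, one_mul]
      rw [← sq_abs (x (e i) - vecMean x)]
      have := abs_sub_abs_le_abs_sub (vecMean x) (x (e i))
      rw [abs_sub_comm] at this
      gcongr <;> linarith
    · rw [Set.indicator_of_notMem (by exact hi), zero_mul]
      positivity
  have h2 : ∑ i, (x (e i) - vecMean x) ^ 2 ≤ n * vecVar x := by
    rw [← sum_sq_sub_vecMean hn, ← Finset.sum_image (s := Finset.univ)
      (f := fun i => (x i - vecMean x) ^ 2) (fun a _ b _ h => he h)]
    exact Finset.sum_le_sum_of_subset_of_nonneg (Finset.subset_univ _)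
      fun _ _ _ => sq_nonneg _
  have h3 := (Finset.sum_le_sum fun i (_ : i ∈ Finset.univ) => h1 i).trans h2
  rw [← Finset.sum_mul, ← sq_vecSd] at h3
  set d := |vecMean x| - 2 - 4 * vecSd x with hd
  have hd0 : 0 < d := by linarith
  have h4 := (mul_le_mul_of_nonneg_right h (sq_nonneg (4 * vecSd x + d))).trans h3
  have h5 : (n : ℝ) ≤ 3 * m := by exact_mod_cast hnm
  have h6 : (n : ℝ) * vecSd x ^ 2 ≤ 3 * m * vecSd x ^ 2 := by gcongr
  have h7 : (4 * vecSd x + d) ^ 2 ≥ 16 * vecSd x ^ 2 + d ^ 2 := by nlinarith [mul_nonneg hs hd0.le]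
  have h8 : (m : ℝ) / 4 * (16 * vecSd x ^ 2 + d ^ 2) ≤ 3 * m * vecSd x ^ 2 :=
    (mul_le_mul_of_nonneg_left h7 (by positivity)).trans (h4.trans h6)
  have : 0 < (m : ℝ) * d ^ 2 := by positivity
  have : 0 ≤ (m : ℝ) * vecSd x ^ 2 := by positivity
  nlinarith

end Statistics

/-! ### Standardised laws and the non-degeneracy of blocks -/

/-- A law on the line with mean zero and variance one. -/
structure IsStandard (Q : Measure ℝ) : Prop where
  integrable_sq : Integrable (fun x : ℝ => x ^ 2) Q
  integral_id : ∫ x, x ∂Q = 0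
  integral_sq : ∫ x, x ^ 2 ∂Q = 1

section Standard

variable {Q : Measure ℝ} [IsProbabilityMeasure Q]

lemma IsStandard.integrable (h : IsStandard Q) : Integrable (fun x : ℝ => x) Q := by
  have : MemLp (fun x : ℝ => x) 2 Q :=
    (memLp_two_iff_integrable_sq (by fun_prop)).2 h.integrable_sq
  exact this.integrable (by norm_num)

lemma IsStandard.three_quarters_le (h : IsStandard Q) : 3 / 4 ≤ Q.real {x : ℝ | |x| ≤ 2} := by
  have hm : MeasurableSet {x : ℝ | |x| ≤ 2} := measurableSet_le (by fun_prop) (by fun_prop)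
  have h1 : (4 : ℝ) * Q.real {x : ℝ | 4 ≤ x ^ 2} ≤ 1 := by
    rw [← h.integral_sq]
    exact mul_meas_ge_le_integral_of_nonneg (ae_of_all _ fun x => sq_nonneg x) h.integrable_sq 4
  have h2 : Q.real {x : ℝ | |x| ≤ 2}ᶜ ≤ Q.real {x : ℝ | 4 ≤ x ^ 2} := by
    refine measureReal_mono fun x hx => ?_
    simp only [Set.mem_compl_iff, Set.mem_ofPred_eq, not_le] at hx ⊢
    rw [← sq_abs]; nlinarith
  rw [measureReal_compl hm, probReal_univ] at h2
  linarith

/-- Cauchy-Schwarz, from the discriminant of the nonnegative quadratic `t ↦ ∫_S (x - t)²`. -/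
lemma sq_setIntegral_le (hi : Integrable (fun x : ℝ => x ^ 2) Q)
    (hi' : Integrable (fun x : ℝ => x) Q) (S : Set ℝ) :
    (∫ x in S, x ∂Q) ^ 2 ≤ Q.real S * ∫ x in S, x ^ 2 ∂Q := by
  have h : ∀ t : ℝ, 0 ≤ Q.real S * (t * t) + (-2 * ∫ x in S, x ∂Q) * t + ∫ x in S, x ^ 2 ∂Q := by
    intro t
    have h0 : 0 ≤ ∫ x in S, (x - t) ^ 2 ∂Q := integral_nonneg fun x => sq_nonneg _
    have h1 : (fun x : ℝ => (x - t) ^ 2) = fun x => x ^ 2 - 2 * t * x + t * t := by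
      ext x; ring
    rw [h1, integral_add (by exact (hi.sub (hi'.const_mul _)).integrableOn) (integrable_const _),
      integral_sub hi.integrableOn (hi'.const_mul _).integrableOn, integral_const_mul] at h0
    simp only [integral_const, measureReal_restrict_apply_univ, smul_eq_mul] at h0
    linarith
  have := discrim_le_zero h
  rw [discrim] at this
  linarith

/-- The squared difference of a pair, restricted to a bounded region. -/
noncomputable def pairGap (a : ℝ) (z : ℝ × ℝ) : ℝ :=
  ({x : ℝ | |x| ≤ 2} ×ˢ {y : ℝ | |y| ≤ a}).indicator (fun z => (z.1 - z.2) ^ 2) z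

lemma measurableSet_abs_le (a : ℝ) : MeasurableSet {x : ℝ | |x| ≤ a} :=
  measurableSet_le (by fun_prop) (by fun_prop)

@[fun_prop]
lemma measurable_pairGap (a : ℝ) : Measurable (pairGap a) :=
  Measurable.indicator (by fun_prop) ((measurableSet_abs_le 2).prod (measurableSet_abs_le a))

lemma pairGap_nonneg (a : ℝ) (z : ℝ × ℝ) : 0 ≤ pairGap a z :=
  Set.indicator_nonneg (fun _ _ => sq_nonneg _) z

lemma pairGap_le (a : ℝ) (z : ℝ × ℝ) : pairGap a z ≤ (z.1 - z.2) ^ 2 :=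
  Set.indicator_le_self' (fun _ _ => sq_nonneg _) z

lemma pairGap_le_bound {a : ℝ} (ha : 2 ≤ a) (z : ℝ × ℝ) : pairGap a z ≤ 4 * a ^ 2 := by
  unfold pairGap
  by_cases h : z ∈ {x : ℝ | |x| ≤ 2} ×ˢ {y : ℝ | |y| ≤ a}
  · rw [Set.indicator_of_mem h]
    obtain ⟨h1, h2⟩ := h
    simp only [Set.mem_ofPred_eq, abs_le] at h1 h2
    nlinarith
  · rw [Set.indicator_of_notMem h]; positivity

lemma pairGap_eq_zero {a : ℝ} {z : ℝ × ℝ} (h : z.1 ∉ {x : ℝ | |x| ≤ 2}) : pairGap a z = 0 :=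
  Set.indicator_of_notMem (fun hz => h hz.1) _

lemma integrable_pairGap {a : ℝ} (ha : 2 ≤ a) : Integrable (pairGap a) (Q.prod Q) :=
  Integrable.of_bound (by fun_prop) (4 * a ^ 2) (ae_of_all _ fun z => by
    rw [Real.norm_of_nonneg (pairGap_nonneg a z)]; exact pairGap_le_bound ha z)

/-- Expanding the square leaves the cross term `2 α β` of the truncated means as the only obstacle.
Since the law is centred, `β` is up to sign the integral over the tail `Bᶜ`, of mass at most `1 / 4`
and second moment at most `1 / 2`, so `β² ≤ 1 / 8`. Weighted AM-GM lets `3 / 4 * α²` be absorbed by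
`u * Q(B)`, leaving `3 / 8 - 1 / 6 = 5 / 24`. -/
lemma IsStandard.integral_pairGap (h : IsStandard Q) {a : ℝ} (ha : 2 ≤ a)
    (hv : 1 / 2 ≤ ∫ x in {x : ℝ | |x| ≤ a}, x ^ 2 ∂Q) :
    1 / 5 ≤ ∫ z, pairGap a z ∂(Q.prod Q) := by
  set C := {x : ℝ | |x| ≤ 2} with hC
  set B := {x : ℝ | |x| ≤ a} with hB
  have hCm : MeasurableSet C := measurableSet_abs_le 2
  have hBm : MeasurableSet B := measurableSet_abs_le a
  have hp := h.three_quarters_le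
  have hpB : 3 / 4 ≤ Q.real B :=
    hp.trans (measureReal_mono fun x (hx : |x| ≤ 2) => (hx.trans ha : |x| ≤ a))
  have hi := h.integrable_sq
  have hi' := h.integrable
  have i1 : ∀ {S : Set ℝ}, MeasurableSet S → Integrable (S.indicator fun _ => (1 : ℝ)) Q :=
    fun hS => (integrable_const 1).indicator hS
  have e1 : pairGap a = fun z : ℝ × ℝ =>
      C.indicator (fun x => x ^ 2) z.1 * B.indicator (fun _ => 1) z.2
      + C.indicator (fun _ => 1) z.1 * B.indicator (fun x => x ^ 2) z.2
      - 2 * (C.indicator (fun x => x) z.1 * B.indicator (fun x => x) z.2) := by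
    ext z
    by_cases h1 : z.1 ∈ C <;> by_cases h2 : z.2 ∈ B <;>
      simp [pairGap, Set.indicator, h1, h2, ← hC, ← hB]
    ring
  have j1 := (hi.indicator hCm).mul_prod (i1 hBm)
  have j2 := (i1 hCm).mul_prod (hi.indicator hBm)
  have j3 := (hi'.indicator hCm).mul_prod (hi'.indicator hBm)
  rw [e1, integral_sub (by exact j1.add j2) (by exact j3.const_mul 2), integral_add j1 j2,
    integral_const_mul, integral_prod_mul, integral_prod_mul, integral_prod_mul]
  simp only [integral_indicator hCm, integral_indicator hBm]
  simp only [integral_const, measureReal_restrict_apply_univ, smul_eq_mul, mul_one]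
  have c1 := sq_setIntegral_le hi hi' C
  have c2 := sq_setIntegral_le hi hi' Bᶜ
  have b1 := integral_add_compl hBm hi'
  have b2 := integral_add_compl hBm hi
  rw [h.integral_id] at b1
  rw [h.integral_sq] at b2
  rw [measureReal_compl hBm, probReal_univ] at c2
  have u0 : 0 ≤ ∫ x in C, x ^ 2 ∂Q := integral_nonneg fun x => sq_nonneg x
  have w0 : 0 ≤ ∫ x in Bᶜ, x ^ 2 ∂Q := integral_nonneg fun x => sq_nonneg x
  have pC1 : Q.real C ≤ 1 := measureReal_le_one
  generalize (∫ x in C, x ^ 2 ∂Q) = u at *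
  generalize (∫ x in B, x ^ 2 ∂Q) = v at *
  generalize (∫ x in C, x ∂Q) = α at *
  generalize (∫ x in B, x ∂Q) = β at *
  generalize (∫ x in Bᶜ, x ∂Q) = β' at *
  generalize (∫ x in Bᶜ, x ^ 2 ∂Q) = w at *
  have hβ : β' = -β := by linarith
  subst hβ
  have d1 : α ^ 2 ≤ u := c1.trans (by nlinarith)
  have d2 : β ^ 2 ≤ 1 / 8 := by nlinarith
  have d3 : 2 * (α * β) ≤ 3 / 4 * α ^ 2 + 4 / 3 * β ^ 2 := by
    nlinarith [sq_nonneg (3 * α - 4 * β)]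
  have d4 : u * (3 / 4) ≤ u * Q.real B := by gcongr
  have d5 : 3 / 4 * (1 / 2) ≤ Q.real C * v := by gcongr
  linarith

variable {m n : ℕ} {e : Fin m ⊕ Fin m → Fin n} {a : ℝ}

lemma exp_neg_le_one_sub_half {t : ℝ} (h0 : 0 ≤ t) (h1 : t ≤ 1) : Real.exp (-t) ≤ 1 - t / 2 := by
  rw [Real.exp_neg]
  have h2 : t + 1 ≤ Real.exp t := Real.add_one_le_exp t
  refine (inv_anti₀ (by linarith) h2).trans ?_
  rw [inv_le_iff_one_le_mul₀ (by linarith)]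
  nlinarith

/-- Lower tail of the restricted squared differences, on the event that the first members of all
pairs lie in `D`. -/
lemma IsStandard.measureReal_sum_pairGap_le (h : IsStandard Q) (ha : 2 ≤ a)
    (hv : 1 / 2 ≤ ∫ x in {x : ℝ | |x| ≤ a}, x ^ 2 ∂Q) (he : Function.Injective e)
    {D : Set ℝ} (hD : MeasurableSet D) (hCD : {x : ℝ | |x| ≤ 2} ⊆ D) :
    (Measure.pi fun _ : Fin n => Q).real {x | (∀ i, x (e (.inl i)) ∈ D) ∧
        ∑ i, pairGap a (x (e (.inl i)), x (e (.inr i))) ≤ m / 20} ≤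
      Q.real D ^ m * Real.exp (-(m / (80 * a ^ 2))) := by
  -- Chernoff parameter: it makes `q * pairGap ≤ 1`, so the exponential lies below the line `1 - t /
  -- 2`. The mean `1 / 5` gains `q / 10` per pair, the threshold `m / 20` costs `q / 20`, and the
  -- net rate is `q / 20 = 1 / (80 a²)`.
  set q : ℝ := 1 / (4 * a ^ 2) with hq
  have hq0 : 0 < q := by positivity
  set F : ℝ × ℝ → ℝ := fun z =>
    Real.exp (q / 20) * (D.indicator (fun _ => 1) z.1 * Real.exp (-(q * pairGap a z))) with hF
  have hFm : Measurable F := by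
    have : Measurable (D.indicator fun _ => (1 : ℝ)) := measurable_const.indicator hD
    fun_prop
  have hF0 : ∀ z, 0 ≤ F z := fun z =>
    mul_nonneg (Real.exp_pos _).le
      (mul_nonneg (Set.indicator_nonneg (fun _ _ => zero_le_one) _) (Real.exp_pos _).le)
  have hFb : ∀ z, F z ≤ Real.exp (q / 20) *
      (D.indicator (fun _ => 1) z.1 - q / 2 * pairGap a z) := by
    intro z
    refine mul_le_mul_of_nonneg_left ?_ (Real.exp_pos _).le
    by_cases hz : z.1 ∈ D
    · rw [Set.indicator_of_mem hz, one_mul]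
      have h1 : q * pairGap a z ≤ 1 := by
        rw [hq, one_div, inv_mul_le_iff₀ (by positivity), mul_one]
        exact pairGap_le_bound ha z
      have := exp_neg_le_one_sub_half (mul_nonneg hq0.le (pairGap_nonneg a z)) h1
      linarith
    -- Restricting first members to `D` loses nothing of the gap, which vanishes outside `[-2, 2] ⊆
    -- D`.
    · rw [Set.indicator_of_notMem hz, pairGap_eq_zero fun hc => hz (hCD hc)]
      simp
  have hI1 : Integrable (fun z : ℝ × ℝ => D.indicator (fun _ => (1 : ℝ)) z.1) (Q.prod Q) :=
    ((integrable_const (1 : ℝ)).indicator hD).comp_fst Q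
  have hI : ∫ z, F z ∂(Q.prod Q) ≤ Q.real D * Real.exp (-(1 / (80 * a ^ 2))) := by
    have h1 : ∫ z, F z ∂(Q.prod Q) ≤ ∫ z, Real.exp (q / 20) *
      (D.indicator (fun _ => 1) z.1 - q / 2 * pairGap a z) ∂(Q.prod Q) := by
      refine integral_mono_of_nonneg (ae_of_all _ hF0) ?_ (ae_of_all _ hFb)
      exact (hI1.sub ((integrable_pairGap ha).const_mul _)).const_mul _
    have hR : ∫ z, Real.exp (q / 20) * (D.indicator (fun _ => 1) z.1 - q / 2 * pairGap a z)
        ∂(Q.prod Q) = Real.exp (q / 20) * (Q.real D - q / 2 * ∫ z, pairGap a z ∂(Q.prod Q)) := by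
      rw [integral_const_mul, integral_sub hI1 ((integrable_pairGap ha).const_mul _),
        integral_const_mul, integral_fun_fst (fun x => D.indicator (fun _ => (1 : ℝ)) x),
        integral_indicator hD]
      simp
    rw [hR] at h1
    have h2 := h.integral_pairGap ha hv
    have hD1 : Q.real D ≤ 1 := measureReal_le_one
    have hD0 : 0 ≤ Q.real D := measureReal_nonneg
    refine h1.trans ?_
    have h3 : Q.real D - q / 2 * ∫ z, pairGap a z ∂(Q.prod Q) ≤ Q.real D * (1 - q / 10) := by
      have : q / 2 * (1 / 5) ≤ q / 2 * ∫ z, pairGap a z ∂(Q.prod Q) := by gcongr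
      nlinarith
    have h4 : 1 - q / 10 ≤ Real.exp (-(q / 10)) := Real.one_sub_le_exp_neg _
    calc _ ≤ Real.exp (q / 20) * (Q.real D * Real.exp (-(q / 10))) := by
          gcongr; exact h3.trans (by gcongr)
      _ = Q.real D * (Real.exp (q / 20) * Real.exp (-(q / 10))) := by ring
      _ = _ := by
        rw [← Real.exp_add]; congr 2; rw [hq]; field_simp; norm_num
  have hS : ∀ x : Fin n → ℝ, ({x : Fin n → ℝ | (∀ i, x (e (.inl i)) ∈ D) ∧
        ∑ i, pairGap a (x (e (.inl i)), x (e (.inr i))) ≤ m / 20}).indicator (fun _ => (1 : ℝ)) x ≤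
      ∏ i, F (x (e (.inl i)), x (e (.inr i))) := by
    intro x
    by_cases hx : x ∈ {x : Fin n → ℝ | (∀ i, x (e (.inl i)) ∈ D) ∧
        ∑ i, pairGap a (x (e (.inl i)), x (e (.inr i))) ≤ m / 20}
    swap
    · rw [Set.indicator_of_notMem hx]
      exact Finset.prod_nonneg fun i _ => hF0 _
    rw [Set.indicator_of_mem hx]
    obtain ⟨hx1, hx2⟩ := hx
    simp only [hF, Set.indicator_of_mem (hx1 _), one_mul, ← Real.exp_add]
    rw [← Real.exp_sum, Finset.sum_add_distrib, Finset.sum_neg_distrib, ← Finset.mul_sum,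
      Finset.sum_const, Finset.card_univ, Fintype.card_fin, nsmul_eq_mul]
    apply Real.one_le_exp
    nlinarith
  have hFle : ∀ z, F z ≤ Real.exp (q / 20) := by
    intro z
    refine (hFb z).trans (mul_le_of_le_one_right (Real.exp_pos _).le ?_)
    have := mul_nonneg (half_pos hq0).le (pairGap_nonneg a z)
    have : D.indicator (fun _ => (1 : ℝ)) z.1 ≤ 1 :=
      Set.indicator_le_self' (fun _ _ => zero_le_one) _
    linarith
  have hmS : MeasurableSet {x : Fin n → ℝ | (∀ i, x (e (.inl i)) ∈ D) ∧
        ∑ i, pairGap a (x (e (.inl i)), x (e (.inr i))) ≤ m / 20} := by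
    rw [Set.ofPred_and, Set.ofPred_forall]
    have hx : ∀ i, Measurable fun x : Fin n → ℝ => x (e (.inl i)) := fun i => by fun_prop
    have hg : Measurable fun x : Fin n → ℝ =>
        ∑ i, pairGap a (x (e (.inl i)), x (e (.inr i))) := by
      fun_prop
    exact (MeasurableSet.iInter fun i => hx i hD).inter (measurableSet_le hg measurable_const)
  calc _ = ∫ x, ({x : Fin n → ℝ | (∀ i, x (e (.inl i)) ∈ D) ∧
        ∑ i, pairGap a (x (e (.inl i)), x (e (.inr i))) ≤ m / 20}).indicator (fun _ => (1 : ℝ)) x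
          ∂(Measure.pi fun _ => Q) := by
        rw [integral_indicator hmS]; simp
    _ ≤ ∫ x, ∏ i, F (x (e (.inl i)), x (e (.inr i))) ∂(Measure.pi fun _ => Q) := by
        refine integral_mono_of_nonneg (ae_of_all _ fun x => Set.indicator_nonneg
          (fun _ _ => zero_le_one) _) ?_ (ae_of_all _ hS)
        refine Integrable.of_bound (Measurable.aestronglyMeasurable (by fun_prop))
          (Real.exp (q / 20) ^ m) (ae_of_all _ fun x => ?_)
        rw [Real.norm_of_nonneg (Finset.prod_nonneg fun i _ => hF0 _)]
        refine (Finset.prod_le_prod (fun i _ => hF0 _) fun i _ => hFle _).trans_eq ?_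
        simp
    _ = (∫ z, F z ∂(Q.prod Q)) ^ m := by
        rw [integral_prod_pairs Q he hFm, Fintype.card_fin]
    _ ≤ (Q.real D * Real.exp (-(1 / (80 * a ^ 2)))) ^ m :=
        pow_le_pow_left₀ (integral_nonneg hF0) hI m
    _ = _ := by
        rw [mul_pow, ← Real.exp_nat_mul]; congr 2; ring

end Standard

/-! ### Good blocks and their exponentially small failure probability. -/

section GoodBlocks

variable {Q : Measure ℝ} [IsProbabilityMeasure Q] {m n : ℕ} {a : ℝ}

/-- The standardised block is non-degenerate and its mean is of the order of its standard
deviation. -/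
def IsGood (x : Fin n → ℝ) : Prop := 1 / 11 ≤ vecSd x ∧ |vecMean x| ≤ 26 * vecSd x

lemma measurableSet_isGood : MeasurableSet {x : Fin n → ℝ | IsGood x} := by
  simp only [IsGood, Set.ofPred_and]
  exact (measurableSet_le (by fun_prop) (by fun_prop)).inter
    (measurableSet_le (by fun_prop) (by fun_prop))

/-- The constants of `IsGood` come from here: the gaps force `vecVar x ≥ 1 / 120 ≥ (1 / 11)²`, and
then `2 + 4 s ≤ 22 s + 4 s`. -/
lemma isGood_of_pairs (hn : n ≠ 0) (hm : 0 < m) (hnm : n ≤ 3 * m) {e : Fin m ⊕ Fin m → Fin n}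
    (he : Function.Injective e) {x : Fin n → ℝ}
    (h1 : (m : ℝ) / 4 ≤ ∑ i, Set.indicator {y : ℝ | |y| ≤ 2} 1 (x (e (.inl i))))
    (h2 : (m : ℝ) / 20 < ∑ i, pairGap a (x (e (.inl i)), x (e (.inr i)))) : IsGood x := by
  have h3 := abs_vecMean_le hn hm hnm (e := fun i => e (.inl i))
    (fun _ _ h => Sum.inl_injective (he h)) x h1
  have h4 := (Finset.sum_le_sum fun i (_ : i ∈ Finset.univ) =>
    pairGap_le a (x (e (.inl i)), x (e (.inr i)))).trans (sum_pairs_sq_sub_le hn he x)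
  have hm' : (0 : ℝ) < m := by exact_mod_cast hm
  have h5 : (n : ℝ) * vecVar x ≤ 3 * m * vecVar x :=
    mul_le_mul_of_nonneg_right (by exact_mod_cast hnm) (vecVar_nonneg x)
  have h6 : 1 / 120 ≤ vecVar x := by
    by_contra! h
    nlinarith
  have h7 : 1 / 11 ≤ vecSd x := Real.le_sqrt_of_sq_le (by linarith)
  exact ⟨h7, by linarith⟩

lemma IsStandard.measureReal_sum_indicator_lt (h : IsStandard Q) {e : Fin m ⊕ Fin m → Fin n}
    (he : Function.Injective e) :
    (Measure.pi fun _ : Fin n => Q).real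
      {x | ∑ i, Set.indicator {y : ℝ | |y| ≤ 2} (1 : ℝ → ℝ) (x (e (.inl i))) < m / 4} ≤
      (19 / 32) ^ m := by
  set C := {y : ℝ | |y| ≤ 2} with hC
  have hCm : MeasurableSet C := measurableSet_abs_le 2
  have hIm : Measurable (C.indicator (1 : ℝ → ℝ)) := measurable_one.indicator hCm
  -- The Chernoff factor `16 ^ (1 / 4 - 1_C)`, written affinely since the indicator takes two
  -- values. Its mean is at most `2 - (15 / 8) * (3 / 4) = 19 / 32`.
  set F : ℝ × ℝ → ℝ := fun z => 2 - (15 / 8) * C.indicator (1 : ℝ → ℝ) z.1 with hF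
  have hFm : Measurable F := by fun_prop
  have hval : ∀ z, F z = Real.exp (Real.log 16 * (1 - C.indicator (1 : ℝ → ℝ) z.1) - Real.log 8) := by
    intro z
    rw [Real.exp_sub, Real.exp_log (by norm_num), hF]
    by_cases hz : z.1 ∈ C
    · simp [Set.indicator_of_mem hz]; norm_num
    · simp [Set.indicator_of_notMem hz, Real.exp_log]; norm_num
  have hF0 : ∀ z, 0 ≤ F z := fun z => by rw [hval]; positivity
  have hF2 : ∀ z, F z ≤ 2 := fun z => by
    have : 0 ≤ C.indicator (1 : ℝ → ℝ) z.1 := Set.indicator_nonneg (fun _ _ => zero_le_one) _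
    simp only [hF]; linarith
  have hlog : Real.log 16 * (3 / 4) = Real.log 8 := by
    rw [show (16 : ℝ) = 2 ^ 4 by norm_num, show (8 : ℝ) = 2 ^ 3 by norm_num, Real.log_pow,
      Real.log_pow]
    push_cast; ring
  have hI : ∫ z, F z ∂(Q.prod Q) ≤ 19 / 32 := by
    have hi : Integrable (fun z : ℝ × ℝ => C.indicator (1 : ℝ → ℝ) z.1) (Q.prod Q) :=
      Integrable.comp_fst ((integrable_const (1 : ℝ)).indicator hCm) Q
    rw [hF, integral_sub (integrable_const _) (hi.const_mul _), integral_const_mul,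
      integral_fun_fst (fun x => C.indicator (1 : ℝ → ℝ) x), integral_indicator_one hCm]
    have := h.three_quarters_le
    simp only [integral_const, probReal_univ, smul_eq_mul, one_mul]
    linarith
  set S := {x : Fin n → ℝ | ∑ i, C.indicator (1 : ℝ → ℝ) (x (e (.inl i))) < m / 4} with hS
  have hSm : MeasurableSet S := measurableSet_lt (Finset.measurable_fun_sum _ fun i _ =>
      hIm.comp (by fun_prop)) measurable_const
  have hle : ∀ x, S.indicator (1 : (Fin n → ℝ) → ℝ) x ≤ ∏ i, F (x (e (.inl i)), x (e (.inr i))) := by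
    intro x
    by_cases hx : x ∈ S
    swap
    · rw [Set.indicator_of_notMem hx]
      exact Finset.prod_nonneg fun i _ => hF0 _
    rw [Set.indicator_of_mem hx]
    simp only [hval]
    rw [← Real.exp_sum, Finset.sum_sub_distrib, ← Finset.mul_sum, Finset.sum_sub_distrib,
      Finset.sum_const, Finset.sum_const, Finset.card_univ, Fintype.card_fin, nsmul_eq_mul,
      nsmul_eq_mul, mul_one, ← hlog]
    apply Real.one_le_exp
    have hx' : ∑ i, C.indicator (1 : ℝ → ℝ) (x (e (.inl i))) < m / 4 := hx
    have : 0 < Real.log 16 := Real.log_pos (by norm_num)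
    nlinarith
  rw [← integral_indicator_one hSm]
  calc _ ≤ ∫ x, ∏ i, F (x (e (.inl i)), x (e (.inr i))) ∂(Measure.pi fun _ => Q) := by
        refine integral_mono_of_nonneg (ae_of_all _ fun x => Set.indicator_nonneg
          (fun _ _ => zero_le_one) _) ?_ (ae_of_all _ hle)
        refine Integrable.of_bound (Measurable.aestronglyMeasurable (by fun_prop))
          (2 ^ m) (ae_of_all _ fun x => ?_)
        rw [Real.norm_of_nonneg (Finset.prod_nonneg fun i _ => hF0 _)]
        refine (Finset.prod_le_prod (fun i _ => hF0 _) fun i _ => hF2 _).trans_eq ?_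
        simp
    _ = (∫ z, F z ∂(Q.prod Q)) ^ m := by
        rw [integral_prod_pairs Q he hFm, Fintype.card_fin]
    _ ≤ _ := pow_le_pow_left₀ (integral_nonneg hF0) hI m

/-- Two bounds on the probability that a block is not good. -/
lemma IsStandard.measureReal_not_isGood_le (h : IsStandard Q) (ha : 2 ≤ a)
    (hv : 1 / 2 ≤ ∫ x in {x : ℝ | |x| ≤ a}, x ^ 2 ∂Q) (hm : 0 < m) (hmn : m + m ≤ n)
    (hnm : n ≤ 3 * m) :
    (Measure.pi fun _ : Fin n => Q).real {x | ¬ IsGood x} ≤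
        (19 / 32) ^ m + Real.exp (-(m / (80 * a ^ 2))) ∧
      (Measure.pi fun _ : Fin n => Q).real {x | ¬ IsGood x} ≤
        1 - (3 / 4) ^ m * (1 - Real.exp (-(m / (80 * a ^ 2)))) := by
  have hn : n ≠ 0 := by omega
  set e : Fin m ⊕ Fin m → Fin n := fun i => Fin.castLE hmn (finSumFinEquiv i)
  have he : Function.Injective e :=
    (Fin.castLE_injective hmn).comp finSumFinEquiv.injective
  set C := {y : ℝ | |y| ≤ 2} with hC
  have hCm : MeasurableSet C := measurableSet_abs_le 2
  set Pn := Measure.pi fun _ : Fin n => Q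
  -- The first bound decays geometrically but may exceed one for small `m`. The second stays below
  -- one for every `m > 0`: with probability at least `(3 / 4) ^ m` all first members lie in `[-2,
  -- 2]`, and then only the gap condition can fail.
  constructor
  · have h1 := h.measureReal_sum_indicator_lt he
    have h2 := h.measureReal_sum_pairGap_le ha hv he MeasurableSet.univ (Set.subset_univ _)
    simp only [probReal_univ, one_pow, one_mul, Set.mem_univ, implies_true, true_and] at h2
    refine (measureReal_mono ?_).trans ((measureReal_union_le _ _).trans (add_le_add h1 h2))
    intro x hx
    by_contra hcon
    simp only [Set.mem_union, Set.mem_ofPred_eq, not_or, not_lt, not_le] at hcon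
    exact hx (isGood_of_pairs hn hm hnm he hcon.1 hcon.2)
  · have h1 := h.measureReal_sum_pairGap_le ha hv he hCm subset_rfl
    set A := {x : Fin n → ℝ | ∀ i, x (e (.inl i)) ∈ C} with hA
    set E := {x : Fin n → ℝ | (∀ i, x (e (.inl i)) ∈ C) ∧
        ∑ i, pairGap a (x (e (.inl i)), x (e (.inr i))) ≤ m / 20} with hE
    have hPA : Pn.real A = Q.real C ^ m := by
      have hmp := measurePreserving_pi_comp_injective Q (κ := Fin m)
        (e := fun i => e (.inl i)) (fun _ _ h => Sum.inl_injective (he h))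
      have : A = (fun (x : Fin n → ℝ) i => x (e (.inl i))) ⁻¹' (Set.univ.pi fun _ => C) := by
        ext x; simp [hA]
      rw [this, measureReal_def, hmp.measure_preimage
        (MeasurableSet.univ_pi fun _ => hCm).nullMeasurableSet, Measure.pi_pi]
      simp [measureReal_def]
    have hsub : A ⊆ E ∪ {x | IsGood x} := by
      intro x hx
      by_contra hcon
      simp only [Set.mem_union, Set.mem_ofPred_eq, not_or, hE, not_and, not_le] at hcon
      refine hcon.2 (isGood_of_pairs hn hm hnm he ?_ (hcon.1 hx))
      have : ∀ i, C.indicator (1 : ℝ → ℝ) (x (e (.inl i))) = 1 := fun i =>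
        Set.indicator_of_mem (hx i) _
      simp only [← hC, this, Finset.sum_const, Finset.card_univ, Fintype.card_fin, nsmul_eq_mul]
      have : (0 : ℝ) ≤ m := by positivity
      linarith
    have h2 : Pn.real A ≤ Pn.real E + Pn.real {x | IsGood x} :=
      (measureReal_mono hsub).trans (measureReal_union_le _ _)
    have h3 : Pn.real {x : Fin n → ℝ | ¬ IsGood x} = 1 - Pn.real {x : Fin n → ℝ | IsGood x} := by
      rw [← probReal_compl_eq_one_sub measurableSet_isGood]; rfl
    have h4 : (3 / 4 : ℝ) ^ m ≤ Q.real C ^ m :=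
      pow_le_pow_left₀ (by norm_num) h.three_quarters_le m
    have h5 : Real.exp (-(m / (80 * a ^ 2))) ≤ 1 := by
      rw [Real.exp_le_one_iff, neg_nonpos]; positivity
    have h6 := mul_le_mul_of_nonneg_right h4 (sub_nonneg.2 h5)
    rw [h3]
    rw [hPA] at h2
    linarith

/-- A sequence that is below one and eventually geometrically small is bounded by an exponential
with unit prefactor. -/
lemma exists_le_exp_neg {g : ℕ → ℝ} {r : ℝ} (hr0 : 0 < r) (hr1 : r < 1)
    (h1 : ∀ m, 0 < m → g m < 1) (h2 : ∀ m, g m ≤ 2 * r ^ m) :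
    ∃ c > 0, ∀ m, 0 < m → g m ≤ Real.exp (-(c * m)) := by
  have hlog : Real.log r < 0 := Real.log_neg hr0 hr1
  obtain ⟨M, hM⟩ : ∃ M : ℕ, ∀ m ≥ M, g m ≤ Real.exp (Real.log r / 2 * m) := by
    obtain ⟨M, hM⟩ := exists_nat_gt (Real.log 2 / (-(Real.log r) / 2))
    refine ⟨M, fun m hm => (h2 m).trans ?_⟩
    have hm' : (M : ℝ) ≤ m := by exact_mod_cast hm
    rw [div_lt_iff₀ (by linarith)] at hM
    nth_rewrite 1 [← Real.exp_log (show (0 : ℝ) < 2 by norm_num)]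
    rw [← Real.exp_log hr0, ← Real.exp_nat_mul, ← Real.exp_add, Real.exp_log hr0, Real.exp_le_exp]
    nlinarith
  have hfin : ∀ M : ℕ, ∃ c > 0, ∀ m, 0 < m → m < M → g m ≤ Real.exp (-(c * m)) := by
    intro M
    induction M with
    | zero => exact ⟨1, one_pos, fun m _ h => absurd h (Nat.not_lt_zero m)⟩
    | succ k ih =>
      obtain ⟨c, hc, hck⟩ := ih
      have mono : ∀ {c' : ℝ} {m : ℕ}, c' ≤ c → Real.exp (-(c * m)) ≤ Real.exp (-(c' * m)) := by
        intro c' m h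
        rw [Real.exp_le_exp, neg_le_neg_iff]; gcongr
      rcases Nat.eq_zero_or_pos k with rfl | hk
      · exact ⟨c, hc, fun m h h' => by omega⟩
      · have hk' : (0 : ℝ) < k := by exact_mod_cast hk
        -- The floor `1 / 2` keeps the logarithm meaningful when `g k ≤ 0`.
        set t := max (g k) (1 / 2) with ht
        have ht0 : 0 < t := lt_max_of_lt_right (by norm_num)
        have ht1 : t < 1 := max_lt (h1 k hk) (by norm_num)
        have hlt := Real.log_neg ht0 ht1
        refine ⟨min c (-Real.log t / k), lt_min hc (div_pos (by linarith) hk'),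
          fun m hm hmk => ?_⟩
        rcases Nat.lt_succ_iff_lt_or_eq.1 hmk with h | rfl
        · exact (hck m hm h).trans (mono (min_le_left _ _))
        · refine (le_max_left (g m) (1 / 2)).trans ?_
          rw [← ht]
          nth_rewrite 1 [← Real.exp_log ht0]
          rw [Real.exp_le_exp, le_neg]
          calc _ ≤ -Real.log t / m * m := by gcongr; exact min_le_right _ _
            _ = _ := by field_simp
  obtain ⟨c, hc, hcM⟩ := hfin M
  refine ⟨min c (-Real.log r / 2), lt_min hc (by linarith), fun m hm => ?_⟩
  rcases lt_or_ge m M with h | h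
  · refine (hcM m hm h).trans ?_
    rw [Real.exp_le_exp, neg_le_neg_iff]; gcongr; exact min_le_left _ _
  · refine (hM m h).trans ?_
    rw [Real.exp_le_exp, le_neg, ← neg_mul]
    gcongr
    exact (min_le_right _ _).trans_eq (by ring)

/-- Blocks are good with exponentially high probability, at a rate that depends on the law only
through its truncation level. -/
lemma exists_rate_not_isGood {a : ℝ} (ha : 2 ≤ a) :
    ∃ c > 0, ∀ (Q : Measure ℝ) [IsProbabilityMeasure Q], IsStandard Q →
      1 / 2 ≤ ∫ x in {x : ℝ | |x| ≤ a}, x ^ 2 ∂Q → ∀ n : ℕ, 2 ≤ n →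
      (Measure.pi fun _ : Fin n => Q).real {x | ¬ IsGood x} ≤ Real.exp (-(c * n)) := by
  set q : ℝ := 1 / (80 * a ^ 2) with hq
  have hq0 : 0 < q := by positivity
  have hexp : ∀ m : ℕ, Real.exp (-(m / (80 * a ^ 2))) = Real.exp (-q) ^ m := by
    intro m; rw [← Real.exp_nat_mul]; congr 1; rw [hq]; ring
  have hq1 : Real.exp (-q) < 1 := by rw [Real.exp_lt_one_iff]; linarith
  obtain ⟨c, hc, hcm⟩ := exists_le_exp_neg
    (g := fun m => min ((19 / 32) ^ m + Real.exp (-q) ^ m)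
      (1 - (3 / 4) ^ m * (1 - Real.exp (-q) ^ m)))
    (r := max (19 / 32) (Real.exp (-q))) (lt_max_of_lt_left (by norm_num))
    (max_lt (by norm_num) hq1)
    (fun m hm => min_lt_of_right_lt (by
      have : Real.exp (-q) ^ m < 1 := pow_lt_one₀ (Real.exp_pos _).le hq1 hm.ne'
      have := mul_pos (show (0 : ℝ) < (3 / 4) ^ m by positivity) (sub_pos.2 this)
      linarith))
    (fun m => (min_le_left _ _).trans (by
      rw [two_mul]
      gcongr
      · exact le_max_left _ _
      · exact le_max_right _ _))
  -- With `n / 2` rounded down, `n ≤ 3 * (n / 2)` holds for all `n ≥ 2`, with equality at `n = 3`.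
  refine ⟨c / 3, by positivity, fun Q _ hQ hv n hn => ?_⟩
  obtain ⟨h1, h2⟩ := hQ.measureReal_not_isGood_le ha hv (m := n / 2) (n := n) (by omega) (by omega)
    (by omega)
  rw [hexp] at h1 h2
  refine (le_min h1 h2).trans ((hcm (n / 2) (by omega)).trans ?_)
  have : (n : ℝ) ≤ 3 * (n / 2 : ℕ) := by exact_mod_cast (by omega : n ≤ 3 * (n / 2))
  rw [Real.exp_le_exp, neg_le_neg_iff]
  nlinarith

end GoodBlocks

/-! ### Exponential moments of self-normalised sums -/

section SelfNormalised

/-- Follows from `(1 - x + x²) (1 + x + x²) = 1 + x² + x⁴ ≥ 1`. The quadratic correction tames the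
exponential for all real `x`, so two moments are enough after integration. -/
lemma exp_sub_sq_le (x : ℝ) : Real.exp (x - x ^ 2) ≤ 1 + x + x ^ 2 := by
  have h1 : x ^ 2 - x + 1 ≤ Real.exp (x ^ 2 - x) := Real.add_one_le_exp _
  have h2 : 0 < x ^ 2 - x + 1 := by nlinarith [sq_nonneg (x - 1 / 2)]
  rw [show x - x ^ 2 = -(x ^ 2 - x) by ring, Real.exp_neg]
  refine (inv_anti₀ h2 h1).trans ?_
  rw [inv_le_iff_one_le_mul₀ h2]
  nlinarith [sq_nonneg (x ^ 2), sq_nonneg x]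

variable {Q : Measure ℝ} [IsProbabilityMeasure Q]

lemma IsStandard.integral_exp_le (h : IsStandard Q) (t : ℝ) :
    ∫ x, Real.exp (t * x - t ^ 2 * x ^ 2) ∂Q ≤ Real.exp (t ^ 2) := by
  have h1 : ∫ x, Real.exp (t * x - t ^ 2 * x ^ 2) ∂Q ≤ ∫ x, (1 + t * x + t ^ 2 * x ^ 2) ∂Q := by
    refine integral_mono_of_nonneg (ae_of_all _ fun x => (Real.exp_pos _).le)
      (((integrable_const _).add (h.integrable.const_mul _)).add (h.integrable_sq.const_mul _))
      (ae_of_all _ fun x => ?_)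
    have := exp_sub_sq_le (t * x)
    rwa [mul_pow] at this
  rw [integral_add (by exact (integrable_const _).add (h.integrable.const_mul _))
    (h.integrable_sq.const_mul _), integral_add (integrable_const _) (h.integrable.const_mul _),
    integral_const_mul, integral_const_mul, h.integral_id, h.integral_sq] at h1
  simp only [integral_const, probReal_univ, smul_eq_mul] at h1
  have := Real.add_one_le_exp (t ^ 2)
  linarith

lemma IsStandard.integral_pi_exp_le (h : IsStandard Q) (n : ℕ) (t : ℝ) :
    ∫ x : Fin n → ℝ, Real.exp (t * ∑ i, x i - t ^ 2 * ∑ i, x i ^ 2) ∂(Measure.pi fun _ => Q) ≤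
      Real.exp (n * t ^ 2) := by
  have h1 : ∀ x : Fin n → ℝ, Real.exp (t * ∑ i, x i - t ^ 2 * ∑ i, x i ^ 2) =
      ∏ i, Real.exp (t * x i - t ^ 2 * x i ^ 2) := by
    intro x
    rw [← Real.exp_sum, Finset.sum_sub_distrib, Finset.mul_sum, Finset.mul_sum]
  simp only [h1]
  rw [integral_fintype_prod_eq_pow (ι := Fin n) fun y : ℝ => Real.exp (t * y - t ^ 2 * y ^ 2),
    Fintype.card_fin, Real.exp_nat_mul]
  exact pow_le_pow_left₀ (integral_nonneg fun x => (Real.exp_pos _).le) (h.integral_exp_le t) n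

lemma lintegral_exp_neg_mul_sq {b : ℝ} (hb : 0 < b) :
    ∫⁻ t : ℝ, ENNReal.ofReal (Real.exp (-b * t ^ 2)) = ENNReal.ofReal √(Real.pi / b) := by
  rw [← integral_gaussian, ofReal_integral_eq_lintegral_ofReal (integrable_exp_neg_mul_sq hb)
    (ae_of_all _ fun _ => (Real.exp_pos _).le)]

lemma lintegral_exp_linear_sub_sq {A : ℝ} (hA : 0 < A) (S : ℝ) :
    ∫⁻ t : ℝ, ENNReal.ofReal (Real.exp (t * S - t ^ 2 * A)) =
      ENNReal.ofReal (√(Real.pi / A) * Real.exp (S ^ 2 / (4 * A))) := by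
  have h1 : ∀ t : ℝ, ENNReal.ofReal (Real.exp (t * S - t ^ 2 * A)) =
      ENNReal.ofReal (Real.exp (S ^ 2 / (4 * A))) *
        ENNReal.ofReal (Real.exp (-A * (t - S / (2 * A)) ^ 2)) := by
    intro t
    rw [← ENNReal.ofReal_mul (Real.exp_pos _).le, ← Real.exp_add]
    congr 2
    field_simp; ring
  simp only [h1]
  rw [lintegral_const_mul _ (by fun_prop),
    lintegral_sub_right_eq_self (fun t => ENNReal.ofReal (Real.exp (-A * t ^ 2))),
    lintegral_exp_neg_mul_sq hA, ← ENNReal.ofReal_mul (Real.exp_pos _).le, mul_comm]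

/-- The self-normalised sum has a Gaussian-type exponential moment, uniformly over all
standardised laws. -/
lemma IsStandard.integral_exp_selfNormalised (h : IsStandard Q) {n : ℕ} (hn : 0 < n) :
    Integrable (fun x : Fin n → ℝ => Real.exp ((∑ i, x i) ^ 2 / (8 * (∑ i, x i ^ 2 + 2 * n))))
        (Measure.pi fun _ => Q) ∧
      ∫ x : Fin n → ℝ, Real.exp ((∑ i, x i) ^ 2 / (8 * (∑ i, x i ^ 2 + 2 * n)))
        ∂(Measure.pi fun _ => Q) ≤ 3 / 2 := by
  have hn' : (0 : ℝ) < n := by exact_mod_cast hn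
  set Pn := Measure.pi fun _ : Fin n => Q
  -- Of the added `2 n`, one `n` cancels the factor `exp (n t²)`; the other leaves the Gaussian `exp
  -- (-n t²)`, integrable in `t`.
  set A : (Fin n → ℝ) → ℝ := fun x => ∑ i, x i ^ 2 + 2 * n with hA
  have hV : ∀ x : Fin n → ℝ, 0 ≤ ∑ i, x i ^ 2 := fun x => Finset.sum_nonneg fun i _ => sq_nonneg _
  have hA0 : ∀ x, 0 < A x := fun x => by have := hV x; simp only [hA]; linarith
  have hAm : Measurable A := by simp only [hA]; fun_prop
  have hexpI : ∀ t : ℝ, Integrable (fun x : Fin n → ℝ =>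
      Real.exp (t * ∑ i, x i - t ^ 2 * ∑ i, x i ^ 2)) Pn := by
    intro t
    refine Integrable.of_bound (Measurable.aestronglyMeasurable (by fun_prop))
      (Real.exp (n * (1 / 4))) (ae_of_all _ fun x => ?_)
    rw [Real.norm_of_nonneg (Real.exp_pos _).le, Real.exp_le_exp, Finset.mul_sum, Finset.mul_sum,
      ← Finset.sum_sub_distrib]
    refine (Finset.sum_le_sum (g := fun _ => (1 / 4 : ℝ)) fun i _ => ?_).trans_eq (by simp)
    nlinarith [sq_nonneg (t * x i - 1 / 2)]
  have key : ∫⁻ x, ENNReal.ofReal (√(Real.pi / A x) * Real.exp ((∑ i, x i) ^ 2 / (4 * A x))) ∂Pn ≤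
      ENNReal.ofReal √(Real.pi / n) := by
    calc _ = ∫⁻ x, (∫⁻ t : ℝ, ENNReal.ofReal (Real.exp (t * ∑ i, x i - t ^ 2 * A x))) ∂Pn :=
          lintegral_congr fun x => (lintegral_exp_linear_sub_sq (hA0 x) _).symm
      _ = ∫⁻ t : ℝ, (∫⁻ x, ENNReal.ofReal (Real.exp (t * ∑ i, x i - t ^ 2 * A x)) ∂Pn) :=
          lintegral_lintegral_swap (Measurable.aemeasurable (by
            simp only [Function.uncurry_def]; fun_prop))
      _ ≤ ∫⁻ t : ℝ, ENNReal.ofReal (Real.exp (-n * t ^ 2)) := by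
          refine lintegral_mono fun t => ?_
          have h1 : ∀ x : Fin n → ℝ, ENNReal.ofReal (Real.exp (t * ∑ i, x i - t ^ 2 * A x)) =
              ENNReal.ofReal (Real.exp (-(2 * n * t ^ 2))) *
              ENNReal.ofReal (Real.exp (t * ∑ i, x i - t ^ 2 * ∑ i, x i ^ 2)) := by
            intro x
            rw [← ENNReal.ofReal_mul (Real.exp_pos _).le, ← Real.exp_add]
            congr 2; simp only [hA]; ring
          simp only [h1]
          rw [lintegral_const_mul _ (by fun_prop), ← ofReal_integral_eq_lintegral_ofReal (hexpI t)
            (ae_of_all _ fun _ => (Real.exp_pos _).le), ← ENNReal.ofReal_mul (Real.exp_pos _).le]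
          refine ENNReal.ofReal_le_ofReal ?_
          refine (mul_le_mul_of_nonneg_left (h.integral_pi_exp_le n t) (Real.exp_pos _).le).trans_eq
            ?_
          rw [← Real.exp_add]; congr 1; ring
      _ = _ := lintegral_exp_neg_mul_sq hn'
  set f : (Fin n → ℝ) → ℝ := fun x => √(Real.pi / A x) * Real.exp ((∑ i, x i) ^ 2 / (4 * A x))
    with hf
  have hf0 : ∀ x, 0 ≤ f x := fun x => by simp only [hf]; positivity
  have hfm : Measurable f := by simp only [hf]; fun_prop
  have hfI : Integrable f Pn := by
    refine ⟨hfm.aestronglyMeasurable, ?_⟩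
    rw [hasFiniteIntegral_iff_ofReal (ae_of_all _ hf0)]
    exact key.trans_lt ENNReal.ofReal_lt_top
  have hfi : ∫ x, f x ∂Pn ≤ √(Real.pi / n) := by
    rw [← ofReal_integral_eq_lintegral_ofReal hfI (ae_of_all _ hf0)] at key
    exact (ENNReal.ofReal_le_ofReal_iff (Real.sqrt_nonneg _)).1 key
  have hxI : ∀ i, Integrable (fun x : Fin n → ℝ => x i ^ 2) Pn := fun i =>
    integrable_comp_eval (μ := fun _ => Q) (f := fun y : ℝ => y ^ 2) h.integrable_sq
  have hVI : Integrable (fun x : Fin n → ℝ => ∑ i, x i ^ 2) Pn :=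
    integrable_finsetSum _ fun i _ => hxI i
  have hAI : Integrable A Pn := hVI.add (integrable_const _)
  have hAi : ∫ x, A x ∂Pn = 3 * n := by
    simp only [hA]
    rw [integral_add hVI (integrable_const _), integral_finsetSum _ fun i _ => hxI i]
    have : ∀ i, ∫ x : Fin n → ℝ, x i ^ 2 ∂Pn = 1 := fun i => by
      rw [integral_comp_eval (μ := fun _ => Q) (f := fun y : ℝ => y ^ 2) (by fun_prop),
        h.integral_sq]
    simp only [this, Finset.sum_const, Finset.card_univ, Fintype.card_fin, integral_const,
      probReal_univ, smul_eq_mul, nsmul_eq_mul]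
    ring
  set κ : ℝ := √(n / Real.pi) with hκ
  have hpi := Real.pi_pos
  have hκf : κ * √(Real.pi / n) = 1 := by
    rw [hκ, ← Real.sqrt_mul (by positivity)]
    rw [show (n : ℝ) / Real.pi * (Real.pi / n) = 1 by field_simp, Real.sqrt_one]
  -- This removes the prefactor `√(π / A)` of the Gaussian integral. With `u = √(A / n)`, use `E ≤
  -- E² / (2 u) + u / 2` and `u ≤ (1 + u²) / 2`; halving the exponent, `8 A` instead of `4 A`, pays
  -- for it. As `E A = 3 n`, the total is `1 / 2 + 1 = 3 / 2`.
  have hle : ∀ x, Real.exp ((∑ i, x i) ^ 2 / (8 * A x)) ≤ 1 / 2 * (κ * f x) + (1 + A x / n) / 4 := by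
    intro x
    set u := √(A x / n) with hu
    have hu0 : 0 < u := Real.sqrt_pos.2 (div_pos (hA0 x) hn')
    have hu2 : u ^ 2 = A x / n := Real.sq_sqrt (div_pos (hA0 x) hn').le
    set E := Real.exp ((∑ i, x i) ^ 2 / (8 * A x)) with hE
    have hE2 : Real.exp ((∑ i, x i) ^ 2 / (4 * A x)) = E ^ 2 := by
      rw [hE, ← Real.exp_nat_mul]; congr 1; push_cast; ring_nf
    have hκu : κ * f x = E ^ 2 / u := by
      simp only [hf]
      rw [hE2, ← mul_assoc, hκ, ← Real.sqrt_mul (by positivity), hu,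
        show (n : ℝ) / Real.pi * (Real.pi / A x) = (A x / n)⁻¹ by
          have := (hA0 x).ne'
          field_simp, Real.sqrt_inv, inv_mul_eq_div]
    rw [hκu, ← hu2]
    have h1 : E ≤ 1 / 2 * (E ^ 2 / u) + u / 2 := by
      have : 0 ≤ (E - u) ^ 2 / (2 * u) := by positivity
      have h2 : (E - u) ^ 2 / (2 * u) = 1 / 2 * (E ^ 2 / u) + u / 2 - E := by
        field_simp; ring
      linarith
    nlinarith [sq_nonneg (u - 1)]
  have hgI : Integrable (fun x => 1 / 2 * (κ * f x) + (1 + A x / n) / 4) Pn :=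
    ((hfI.const_mul _).const_mul _).add (((integrable_const _).add (hAI.div_const _)).div_const _)
  refine ⟨hgI.mono' (Measurable.aestronglyMeasurable (by fun_prop)) (ae_of_all _ fun x => ?_), ?_⟩
  · rw [Real.norm_of_nonneg (Real.exp_pos _).le]
    exact hle x
  · refine (integral_mono_of_nonneg (ae_of_all _ fun x => (Real.exp_pos _).le) hgI
      (ae_of_all _ hle)).trans ?_
    have h2 : Integrable (fun x => 1 + A x / n) Pn := (integrable_const _).add (hAI.div_const _)
    rw [integral_add ((hfI.const_mul _).const_mul _) (h2.div_const _), integral_const_mul,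
      integral_const_mul, integral_div, integral_add (integrable_const _) (hAI.div_const _),
      integral_div, hAi]
    simp only [integral_const, probReal_univ, smul_eq_mul]
    have h1 : κ * ∫ x, f x ∂Pn ≤ 1 := hκf ▸ mul_le_mul_of_nonneg_left hfi (Real.sqrt_nonneg _)
    rw [show 3 * (n : ℝ) / n = 3 by field_simp]
    linarith

end SelfNormalised

/-! ### Sub-Gaussian variables -/

section Subgaussian

/-- The linear term disappears for a centred variable, leaving only the exponential square moment.
-/
lemma exp_le_add_exp_sq (x : ℝ) : Real.exp x ≤ x + Real.exp (x ^ 2) := by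
  have h2 := Real.add_one_le_exp (x ^ 2)
  rcases le_total 1 x with h | h
  · have : Real.exp x ≤ Real.exp (x ^ 2) := Real.exp_le_exp.2 (by nlinarith)
    linarith
  rcases le_total (-1) x with h' | h'
  · have := (abs_le.1 (Real.abs_exp_sub_one_sub_id_le (abs_le.2 ⟨h', h⟩))).2
    linarith
  · have : Real.exp x ≤ 1 := Real.exp_le_one_iff.2 (by linarith)
    nlinarith

variable {Ω : Type*} [MeasurableSpace Ω] {Pr : Measure Ω} [IsProbabilityMeasure Pr]

/-- A random variable with a bounded exponential square moment is sub-Gaussian after centring. -/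
lemma hasSubgaussianMGF_sub_integral {Y : Ω → ℝ} (hY : AEMeasurable Y Pr) {b : NNReal}
    (hb : 0 < b) (hI : Integrable (fun ω => Real.exp (Y ω ^ 2 / b)) Pr)
    (hle : ∫ ω, Real.exp (Y ω ^ 2 / b) ∂Pr ≤ 3 / 2) :
    HasSubgaussianMGF (fun ω => Y ω - ∫ ω', Y ω' ∂Pr) (4 * b) Pr := by
  have hb' : (0 : ℝ) < b := by exact_mod_cast hb
  -- Convexity gives `exp (θ y) ≤ 1 - θ + θ exp y`, so the bound `3 / 2` turns into `1 + θ / 2 ≤ exp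
  -- (θ / 2)`, without a constant prefactor.
  have hmom : ∀ θ : ℝ, 0 ≤ θ → θ ≤ 1 → Integrable (fun ω => Real.exp (θ * (Y ω ^ 2 / b))) Pr ∧
      ∫ ω, Real.exp (θ * (Y ω ^ 2 / b)) ∂Pr ≤ Real.exp (θ / 2) := by
    intro θ h0 h1
    have hconv : ∀ ω, Real.exp (θ * (Y ω ^ 2 / b)) ≤ (1 - θ) + θ * Real.exp (Y ω ^ 2 / b) := by
      intro ω
      have := convexOn_exp.2 (Set.mem_univ (0 : ℝ)) (Set.mem_univ (Y ω ^ 2 / b))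
        (sub_nonneg.2 h1) h0 (by ring)
      simpa using this
    have hg : Integrable (fun ω => (1 - θ) + θ * Real.exp (Y ω ^ 2 / b)) Pr :=
      (integrable_const _).add (hI.const_mul _)
    refine ⟨hg.mono' (by fun_prop) (ae_of_all _ fun ω => ?_), ?_⟩
    · rw [Real.norm_of_nonneg (Real.exp_pos _).le]; exact hconv ω
    · refine (integral_mono_of_nonneg (ae_of_all _ fun ω => (Real.exp_pos _).le) hg
        (ae_of_all _ hconv)).trans ?_
      rw [integral_add (integrable_const _) (hI.const_mul _), integral_const_mul]
      simp only [integral_const, probReal_univ, smul_eq_mul]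
      have := Real.add_one_le_exp (θ / 2)
      nlinarith
  have hsqle : ∀ ω, Y ω ^ 2 ≤ b * (Real.exp (Y ω ^ 2 / b) - 1) := by
    intro ω
    have := Real.add_one_le_exp (Y ω ^ 2 / b)
    calc Y ω ^ 2 = b * (Y ω ^ 2 / b) := by field_simp
      _ ≤ _ := by gcongr; linarith
  have hgI : Integrable (fun ω => b * (Real.exp (Y ω ^ 2 / b) - 1)) Pr :=
    (hI.sub (integrable_const _)).const_mul _
  have hsqI : Integrable (fun ω => Y ω ^ 2) Pr :=
    hgI.mono' (by fun_prop) (ae_of_all _ fun ω => by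
      rw [Real.norm_of_nonneg (sq_nonneg _)]; exact hsqle ω)
  have hL2 : MemLp Y 2 Pr := (memLp_two_iff_integrable_sq hY.aestronglyMeasurable).2 hsqI
  have hYI : Integrable Y Pr := hL2.integrable (by norm_num)
  set μ := ∫ ω, Y ω ∂Pr with hμ
  have hμ2 : μ ^ 2 ≤ b / 2 := by
    have h1 : μ ^ 2 ≤ ∫ ω, Y ω ^ 2 ∂Pr := by
      have := variance_nonneg Y Pr
      rw [variance_eq_sub hL2] at this
      simp only [Pi.pow_apply] at this
      linarith
    have h2 : ∫ ω, Y ω ^ 2 ∂Pr ≤ ∫ ω, b * (Real.exp (Y ω ^ 2 / b) - 1) ∂Pr :=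
      integral_mono hsqI hgI hsqle
    rw [integral_const_mul, integral_sub hI (integrable_const _)] at h2
    simp only [integral_const, probReal_univ, smul_eq_mul, mul_one] at h2
    nlinarith
  have hexpI : ∀ t : ℝ, (∀ ω, Real.exp (t * (Y ω - μ)) ≤
      Real.exp (t ^ 2 * b + 1 / 4) * Real.exp (1 / 2 * (Y ω ^ 2 / b))) := by
    intro t ω
    rw [← Real.exp_add, Real.exp_le_exp]
    have h1 : t * Y ω ≤ t ^ 2 * b / 2 + Y ω ^ 2 / (2 * b) := by
      have : 0 ≤ (t * b - Y ω) ^ 2 / (2 * b) := by positivity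
      have h2 : (t * b - Y ω) ^ 2 / (2 * b) = t ^ 2 * b / 2 + Y ω ^ 2 / (2 * b) - t * Y ω := by
        field_simp; ring
      linarith
    have h2 : -(t * μ) ≤ t ^ 2 * b / 2 + μ ^ 2 / (2 * b) := by
      have : 0 ≤ (t * b + μ) ^ 2 / (2 * b) := by positivity
      have h2 : (t * b + μ) ^ 2 / (2 * b) = t ^ 2 * b / 2 + μ ^ 2 / (2 * b) + t * μ := by
        field_simp; ring
      linarith
    have h3 : μ ^ 2 / (2 * b) ≤ 1 / 4 := by
      rw [div_le_iff₀ (by positivity)]; linarith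
    have h4 : Y ω ^ 2 / (2 * b) = 1 / 2 * (Y ω ^ 2 / b) := by field_simp
    rw [← h4]
    linarith
  have hint : ∀ t : ℝ, Integrable (fun ω => Real.exp (t * (Y ω - μ))) Pr := fun t =>
    ((hmom (1 / 2) (by norm_num) (by norm_num)).1.const_mul _).mono' (by fun_prop)
      (ae_of_all _ fun ω => by rw [Real.norm_of_nonneg (Real.exp_pos _).le]; exact hexpI t ω)
  refine ⟨hint, fun t => ?_⟩
  have hgoal : ((4 * b : NNReal) : ℝ) * t ^ 2 / 2 = 2 * (t ^ 2 * b) := by push_cast; ring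
  rw [hgoal]
  unfold mgf
  -- Small `t`: centring and `exp_le_add_exp_sq`, with `θ = 2 t² b ≤ 1`. Large `t`: Young's
  -- inequality costs a factor `exp (1 / 2)`, which `exp (t² b)` absorbs.
  rcases le_total (2 * (t ^ 2 * b)) 1 with ht | ht
  · obtain ⟨m1, m2⟩ := hmom (2 * (t ^ 2 * b)) (by positivity) ht
    have hpt : ∀ ω, Real.exp (t * (Y ω - μ)) ≤ t * (Y ω - μ) +
        Real.exp (t ^ 2 * b) * Real.exp (2 * (t ^ 2 * b) * (Y ω ^ 2 / b)) := by
      intro ω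
      refine (exp_le_add_exp_sq _).trans (add_le_add le_rfl ?_)
      rw [← Real.exp_add, Real.exp_le_exp,
        show 2 * (t ^ 2 * b) * (Y ω ^ 2 / b) = 2 * t ^ 2 * Y ω ^ 2 by field_simp]
      have : (Y ω - μ) ^ 2 ≤ 2 * Y ω ^ 2 + 2 * μ ^ 2 := by nlinarith [sq_nonneg (Y ω + μ)]
      rw [mul_pow]
      nlinarith [sq_nonneg t, mul_le_mul_of_nonneg_left this (sq_nonneg t),
        mul_le_mul_of_nonneg_left hμ2 (sq_nonneg t)]
    have hc : Integrable (fun ω => t * (Y ω - μ)) Pr := (hYI.sub (integrable_const _)).const_mul _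
    refine (integral_mono (hint t) (hc.add (m1.const_mul _)) hpt).trans ?_
    simp only [Pi.add_apply]
    rw [integral_add hc (m1.const_mul _), integral_const_mul, integral_const_mul,
      integral_sub hYI (integrable_const _)]
    simp only [integral_const, probReal_univ, smul_eq_mul, one_mul, ← hμ, sub_self, mul_zero,
      zero_add]
    calc _ ≤ Real.exp (t ^ 2 * b) * Real.exp (2 * (t ^ 2 * b) / 2) := by gcongr
      _ = _ := by rw [← Real.exp_add]; congr 1; ring
  · obtain ⟨m1, m2⟩ := hmom (1 / 2) (by norm_num) (by norm_num)
    refine (integral_mono (hint t) (m1.const_mul _) (hexpI t)).trans ?_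
    rw [integral_const_mul]
    calc _ ≤ Real.exp (t ^ 2 * b + 1 / 4) * Real.exp (1 / 2 / 2) := by gcongr
      _ ≤ _ := by rw [← Real.exp_add, Real.exp_le_exp]; linarith

/-- Two-sided deviation bound for the average of independent sub-Gaussian variables. -/
lemma measureReal_abs_sum_ge_le {k : ℕ} (hk : 0 < k) {Z : Fin k → Ω → ℝ} {c : NNReal}
    (hc : 0 < c) (hind : iIndepFun Z Pr) (hZ : ∀ j, HasSubgaussianMGF (Z j) c Pr) {s : ℝ}
    (hs : 0 ≤ s) :
    Pr.real {ω | √(2 * k * c * s) ≤ |∑ j, Z j ω|} ≤ 2 * Real.exp (-s) := by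
  have hk' : (0 : ℝ) < k := by exact_mod_cast hk
  have hc' : (0 : ℝ) < c := by exact_mod_cast hc
  have hsum := HasSubgaussianMGF.sum_of_iIndepFun hind (s := Finset.univ) fun i _ => hZ i
  have h1 := hsum.measure_ge_le (Real.sqrt_nonneg (2 * k * c * s))
  have h2 := hsum.neg.measure_ge_le (Real.sqrt_nonneg (2 * k * c * s))
  have he : -√(2 * k * c * s) ^ 2 / (2 * ((∑ i : Fin k, c : NNReal) : ℝ)) = -s := by
    rw [Real.sq_sqrt (by positivity)]
    simp only [Finset.sum_const, Finset.card_univ, Fintype.card_fin, nsmul_eq_mul, NNReal.coe_mul,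
      NNReal.coe_natCast]
    field_simp
  rw [he] at h1 h2
  rw [two_mul (Real.exp (-s))]
  refine le_trans ?_ ((measureReal_union_le _ _).trans (add_le_add h1 h2))
  refine measureReal_mono fun ω hω => ?_
  simp only [Set.mem_union, Set.mem_ofPred_eq, Pi.neg_apply] at hω ⊢
  exact le_abs.1 hω

end Subgaussian

/-! ### The weighted block mean -/

section Score

/-- The block mean weighted by the inverse power of the block standard deviation, on good
blocks. -/
noncomputable def score {n : ℕ} (p : ℝ) : (Fin n → ℝ) → ℝ :=
  {x : Fin n → ℝ | IsGood x}.indicator fun x => vecMean x / vecSd x ^ p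

/-- The inverse power of the truncated standard deviation, as a function of the variance. -/
noncomputable def truncWeight (p v : ℝ) : ℝ := 1 / max (√v) (1 / 11) ^ p

@[fun_prop]
lemma measurable_truncWeight (p : ℝ) : Measurable (truncWeight p) := by
  unfold truncWeight; fun_prop

variable {n : ℕ} {p : ℝ}

@[fun_prop]
lemma measurable_score : Measurable (score (n := n) p) :=
  Measurable.indicator (by fun_prop) measurableSet_isGood

/-- Keeps exactly one inverse power of `s`, the one that self-normalises the mean; the others cost a
constant depending on `p`. -/
lemma one_div_rpow_le {s : ℝ} (hp : 1 ≤ p) (hs : 1 / 11 ≤ s) : 1 / s ^ p ≤ 11 ^ p / (11 * s) := by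
  have hs0 : 0 < s := by linarith
  have h1 : 11 * s ≤ 11 ^ p * s ^ p := by
    rw [← Real.mul_rpow (by norm_num) hs0.le]
    exact Real.self_le_rpow_of_one_le (by linarith) hp
  rw [div_le_div_iff₀ (by positivity) (by positivity)]
  linarith

lemma truncWeight_nonneg (p v : ℝ) : 0 ≤ truncWeight p v := by
  unfold truncWeight; positivity

lemma truncWeight_le (hp : 1 ≤ p) (v : ℝ) : truncWeight p v ≤ 11 ^ p := by
  have hu : 1 / 11 ≤ max (√v) (1 / 11) := le_max_right _ _
  refine (one_div_rpow_le hp hu).trans ?_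
  exact div_le_self (by positivity) (by linarith)

/-- Truncation at `1 / 11` makes the weight bounded and Lipschitz in the variance: `u' + u ≥ 2 / 11`
turns a difference of squares into one of roots, and Bernoulli's inequality handles the power `p`.
The cap at one matters later because `|x|³` need not be integrable. -/
lemma abs_truncWeight_sub_le (hp : 1 ≤ p) {v w : ℝ} (hv : 0 ≤ v) (hw : 0 ≤ w) :
    |truncWeight p v - truncWeight p w| ≤ p * 11 ^ (p + 2) * min 1 |v - w| := by
  wlog hvw : v ≤ w generalizing v w
  · rw [abs_sub_comm, abs_sub_comm v]
    exact this hw hv (le_of_not_ge hvw)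
  have hpow : (11 : ℝ) ^ (p + 2) = 121 * 11 ^ p := by
    rw [Real.rpow_add (by norm_num)]; norm_num; ring
  have hP : 0 < (11 : ℝ) ^ p := by positivity
  rw [mul_min_of_nonneg _ _ (by positivity), le_min_iff]
  constructor
  · have h1 := truncWeight_nonneg p v
    have h2 := truncWeight_nonneg p w
    have h3 := truncWeight_le hp v
    have h4 := truncWeight_le hp w
    rw [abs_le, hpow]
    constructor <;> nlinarith
  · set u := max (√v) (1 / 11) with hu
    set u' := max (√w) (1 / 11) with hu'
    have hu1 : 1 / 11 ≤ u := le_max_right _ _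
    have hu0 : 0 < u := by linarith
    have huu : u ≤ u' := max_le_max (Real.sqrt_le_sqrt hvw) le_rfl
    have hu0' : 0 < u' := by linarith
    have hsq : u' ^ 2 - u ^ 2 ≤ w - v := by
      have e1 := Real.sq_sqrt hv
      have e2 := Real.sq_sqrt hw
      have n1 := Real.sqrt_nonneg v
      have n2 := Real.sqrt_nonneg w
      rcases max_cases (√w) (1 / 11) with ⟨h, h'⟩ | ⟨h, h'⟩
      · have : √v ≤ u := le_max_left _ _
        rw [hu', h, e2]
        nlinarith
      · rw [hu', h]
        nlinarith
    have hdiff : u' - u ≤ 11 / 2 * (w - v) := by nlinarith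
    have hb : 1 - p * (u' - u) / u' ≤ (u / u') ^ p := by
      have := one_add_mul_self_le_rpow_one_add (s := u / u' - 1) (by
        have : 0 ≤ u / u' := by positivity
        linarith) hp
      rw [add_sub_cancel] at this
      refine le_trans (le_of_eq ?_) this
      field_simp
      ring
    have hle : truncWeight p w ≤ truncWeight p v := by
      unfold truncWeight
      exact one_div_le_one_div_of_le (by positivity)
        (Real.rpow_le_rpow hu0.le huu (by linarith))
    rw [abs_of_nonneg (sub_nonneg.2 hle), abs_sub_comm, abs_of_nonneg (sub_nonneg.2 hvw)]
    have hfac : truncWeight p v - truncWeight p w = truncWeight p v * (1 - (u / u') ^ p) := by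
      unfold truncWeight
      rw [Real.div_rpow hu0.le hu0'.le, ← hu, ← hu']
      have : 0 < u ^ p := by positivity
      field_simp
    have h11 : (u' - u) / u' ≤ 11 * (u' - u) := by
      rw [div_le_iff₀ hu0']
      nlinarith
    calc _ = truncWeight p v * (1 - (u / u') ^ p) := hfac
      _ ≤ truncWeight p v * (p * ((u' - u) / u')) := by
          refine mul_le_mul_of_nonneg_left ?_ (truncWeight_nonneg _ _)
          rw [mul_div_assoc] at hb
          linarith
      _ ≤ 11 ^ p * (p * (11 * (11 / 2 * (w - v)))) := by
          have h0 : 0 ≤ (u' - u) / u' := div_nonneg (by linarith) hu0'.le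
          gcongr
          · exact truncWeight_le hp v
          · exact h11.trans (by gcongr)
      _ ≤ _ := by
          rw [hpow]
          have : 0 ≤ p * 11 ^ p * (w - v) := by
            have := sub_nonneg.2 hvw
            positivity
          nlinarith

/-- On a good block `V + 2 n ≤ (1 + 26² + 2 * 121) n s² = 919 n s²`, where `V = ∑ x_i²`, and `8 *
919 ≤ 121 * 61` fixes the constant `61`. -/
lemma sq_score_div_le (hp : 1 ≤ p) (hn : 0 < n) (x : Fin n → ℝ) :
    score p x ^ 2 / (61 * (11 ^ p) ^ 2 / n) ≤
      (∑ i, x i) ^ 2 / (8 * (∑ i, x i ^ 2 + 2 * n)) := by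
  have hn' : (0 : ℝ) < n := by exact_mod_cast hn
  have hrhs : 0 ≤ (∑ i, x i) ^ 2 / (8 * (∑ i, x i ^ 2 + 2 * n)) := by positivity
  by_cases hx : x ∈ {x : Fin n → ℝ | IsGood x}
  swap
  · rw [score, Set.indicator_of_notMem hx]; simpa using hrhs
  rw [score, Set.indicator_of_mem hx]
  obtain ⟨h1, h2⟩ := hx
  rw [sum_sq_eq hn.ne', sum_eq_mul_vecMean hn.ne', ← sq_vecSd]
  have h3 := one_div_rpow_le hp h1
  set s := vecSd x
  set m := vecMean x
  set L : ℝ := 11 ^ p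
  have hs : 0 < s := by linarith
  have hL : 0 < L := by positivity
  have h4 : (m / s ^ p) ^ 2 ≤ L ^ 2 * m ^ 2 / (121 * s ^ 2) := by
    have h5 : (1 / s ^ p) ^ 2 ≤ (L / (11 * s)) ^ 2 := pow_le_pow_left₀ (by positivity) h3 2
    calc (m / s ^ p) ^ 2 = m ^ 2 * (1 / s ^ p) ^ 2 := by ring
      _ ≤ m ^ 2 * (L / (11 * s)) ^ 2 := by gcongr
      _ = _ := by rw [div_pow]; ring
  have h6 : m ^ 2 ≤ 676 * s ^ 2 := by
    rw [← sq_abs]; nlinarith [abs_nonneg m]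
  have h7 : n * s ^ 2 + n * m ^ 2 + 2 * n ≤ 919 * (n * s ^ 2) := by
    have : 1 ≤ 121 * s ^ 2 := by nlinarith
    nlinarith
  calc _ ≤ L ^ 2 * m ^ 2 / (121 * s ^ 2) / (61 * L ^ 2 / n) := by gcongr
    _ = (n * m) ^ 2 / (7381 * (n * s ^ 2)) := by field_simp; ring
    _ ≤ _ := by
      refine div_le_div_of_nonneg_left (sq_nonneg _) (by positivity) ?_
      have : 0 ≤ n * s ^ 2 := by positivity
      linarith

variable {Q : Measure ℝ} [IsProbabilityMeasure Q]

lemma IsStandard.hasSubgaussianMGF_score (h : IsStandard Q) (hp : 1 ≤ p) (hn : 0 < n) :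
    HasSubgaussianMGF (fun x => score p x - ∫ y, score p y ∂(Measure.pi fun _ : Fin n => Q))
      (4 * (61 * (11 ^ p) ^ 2 / n)) (Measure.pi fun _ : Fin n => Q) := by
  obtain ⟨h1, h2⟩ := h.integral_exp_selfNormalised hn
  have hn' : (0 : ℝ) < n := by exact_mod_cast hn
  have hle : ∀ x : Fin n → ℝ, Real.exp (score p x ^ 2 / ((61 * (11 ^ p) ^ 2 / n : NNReal) : ℝ)) ≤
      Real.exp ((∑ i, x i) ^ 2 / (8 * (∑ i, x i ^ 2 + 2 * n))) := by
    intro x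
    rw [Real.exp_le_exp]
    exact_mod_cast sq_score_div_le hp hn x
  have hI : Integrable (fun x : Fin n → ℝ =>
      Real.exp (score p x ^ 2 / ((61 * (11 ^ p) ^ 2 / n : NNReal) : ℝ)))
      (Measure.pi fun _ => Q) :=
    h1.mono' (Measurable.aestronglyMeasurable (by fun_prop)) (ae_of_all _ fun x => by
      rw [Real.norm_of_nonneg (Real.exp_pos _).le]; exact hle x)
  refine hasSubgaussianMGF_sub_integral (by fun_prop) ?_ hI ((integral_mono hI h1 hle).trans h2)
  have : (0 : NNReal) < n := by exact_mod_cast hn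
  have : (0 : NNReal) < 11 ^ p := NNReal.rpow_pos (by norm_num)
  positivity

end Score

/-! ### The bias of the weighted block mean -/

section Bias

variable {n : ℕ} {p : ℝ} {Q : Measure ℝ} [IsProbabilityMeasure Q]

/-- The rate of the bias of a weighted block mean over a block of size `n`. -/
noncomputable def biasRate (Q : Measure ℝ) (c : ℝ) (n : ℕ) : ℝ :=
  ∫ x, |x| * min 1 (x ^ 2 / n) ∂Q + 2 / n + Real.exp (-(c * n) / 2)

/-- The influence of `x i` splits into a term in `x i` alone and a cross term whose second factor is
independent of `x i`. Zeroing the coordinate, rather than deleting it, keeps the length `n`. -/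
lemma abs_vecVar_sub_update_le (hn : 0 < n) (x : Fin n → ℝ) (i : Fin n) :
    |vecVar x - vecVar (Function.update x i 0)| ≤
      x i ^ 2 / n + 2 / n * (|x i| * |vecMean (Function.update x i 0)|) := by
  have hn' : (0 : ℝ) < n := by exact_mod_cast hn
  have hn1 : (1 : ℝ) ≤ n := by exact_mod_cast hn
  set y := Function.update x i 0 with hy
  have hs : ∀ f : ℝ → ℝ, f 0 = 0 → ∑ j, f (x j) = f (x i) + ∑ j, f (y j) := by
    intro f hf
    have h1 := Finset.sum_update_of_mem (Finset.mem_univ i) (fun j => f (x j)) 0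
    have h2 : ∀ j, Function.update (fun j => f (x j)) i 0 j = f (y j) := by
      intro j
      by_cases hj : j = i
      · subst hj; simp [hy, hf]
      · simp [hy, hj]
    simp only [h2, zero_add] at h1
    rw [h1, ← Finset.add_sum_erase _ _ (Finset.mem_univ i), Finset.sdiff_singleton_eq_erase]
  have h1 := hs (fun t => t) rfl
  have h2 := hs (fun t => t ^ 2) (by norm_num)
  rw [sum_eq_mul_vecMean hn.ne', sum_eq_mul_vecMean hn.ne'] at h1
  rw [sum_sq_eq hn.ne', sum_sq_eq hn.ne'] at h2
  have e1 : vecMean x = vecMean y + x i / n := by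
    field_simp; linarith
  have e2 : vecVar x - vecVar y = x i ^ 2 / n - x i ^ 2 / n ^ 2 - 2 * (x i * vecMean y) / n := by
    have : vecVar x - vecVar y = x i ^ 2 / n - (vecMean x ^ 2 - vecMean y ^ 2) := by
      field_simp; linarith
    rw [this, e1]; field_simp; ring
  have e3 : |x i| * |vecMean y| = |x i * vecMean y| := (abs_mul _ _).symm
  have e4 : x i ^ 2 / n ^ 2 ≤ x i ^ 2 / n := by
    gcongr
    nlinarith
  have e5 : 0 ≤ x i ^ 2 / n ^ 2 := by positivity
  have e6 : 2 * (x i * vecMean y) / n = 2 / n * (x i * vecMean y) := by ring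
  have e7 : (0 : ℝ) ≤ 2 / n := by positivity
  rw [e2, e3, e6, abs_le]
  have e8 := mul_le_mul_of_nonneg_left (le_abs_self (x i * vecMean y)) e7
  have e9 := mul_le_mul_of_nonneg_left (neg_abs_le (x i * vecMean y)) e7
  constructor <;> linarith

lemma indepFun_eval_update (i : Fin n) :
    IndepFun (fun x : Fin n → ℝ => x i) (fun x => Function.update x i 0)
      (Measure.pi fun _ => Q) := by
  have h0 : iIndepFun (fun (j : Fin n) (x : Fin n → ℝ) => x j) (Measure.pi fun _ => Q) :=
    iIndepFun_pi (X := fun _ => id) fun _ => aemeasurable_id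
  have h1 := h0.indepFun_finset {i} {i}ᶜ disjoint_compl_right (fun j => measurable_pi_apply j)
  have hψ : Measurable fun (y : (({i}ᶜ : Finset (Fin n)) → ℝ)) (j : Fin n) =>
      if hj : j ∈ ({i}ᶜ : Finset (Fin n)) then y ⟨j, hj⟩ else 0 := by
    refine measurable_pi_lambda _ fun j => ?_
    by_cases hj : j ∈ ({i}ᶜ : Finset (Fin n))
    · simp only [hj, dite_true]; fun_prop
    · simp only [hj, dite_false]; fun_prop
  have h2 := h1.comp (measurable_pi_apply (⟨i, Finset.mem_singleton_self i⟩ : ({i} : Finset (Fin n))))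
    hψ
  convert h2 using 1
  · rfl
  · funext x j
    by_cases hj : j = i
    · subst hj; simp
    · simp [hj]

lemma measurable_update_zero (i : Fin n) :
    Measurable fun x : Fin n → ℝ => Function.update x i (0 : ℝ) := by
  refine measurable_pi_lambda _ fun j => ?_
  by_cases hj : j = i
  · subst hj; simp
  · simp only [Function.update_of_ne hj]; fun_prop

lemma IsStandard.integral_abs_le (h : IsStandard Q) : ∫ x, |x| ∂Q ≤ 1 := by
  have h1 : ∫ x, |x| ∂Q ≤ ∫ x, (1 + x ^ 2) / 2 ∂Q := by
    refine integral_mono h.integrable.abs (((integrable_const _).add h.integrable_sq).div_const _)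
      fun x => ?_
    have := sq_nonneg (|x| - 1)
    rw [sub_sq, sq_abs] at this
    simp only
    linarith
  rw [integral_div, integral_add (integrable_const _) h.integrable_sq, h.integral_sq] at h1
  simpa using h1

/-- Leave-one-out: with `x i` zeroed inside the variance the product has expectation zero, so only
the change of the weight counts. -/
lemma IsStandard.abs_integral_mul_truncWeight_le (h : IsStandard Q) (hp : 1 ≤ p) (hn : 0 < n)
    (i : Fin n) :
    |∫ x : Fin n → ℝ, x i * truncWeight p (vecVar x) ∂(Measure.pi fun _ => Q)| ≤
      p * 11 ^ (p + 2) * (∫ x, |x| * min 1 (x ^ 2 / n) ∂Q + 2 / n) := by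
  have hn' : (0 : ℝ) < n := by exact_mod_cast hn
  set Pn := Measure.pi fun _ : Fin n => Q with hPn
  set K : ℝ := p * 11 ^ (p + 2) with hK
  have hK0 : 0 < K := by positivity
  have hup := measurable_update_zero i
  have hind := indepFun_eval_update (Q := Q) i
  have hev : ∀ j, Integrable (fun x : Fin n → ℝ => x j) Pn := fun j =>
    integrable_comp_eval (μ := fun _ => Q) (f := fun y : ℝ => y) h.integrable
  have hev2 : ∀ j, Integrable (fun x : Fin n → ℝ => x j ^ 2) Pn := fun j =>
    integrable_comp_eval (μ := fun _ => Q) (f := fun y : ℝ => y ^ 2) h.integrable_sq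
  have hbd : ∀ {g : (Fin n → ℝ) → ℝ}, Measurable g →
      Integrable (fun x => x i * truncWeight p (g x)) Pn := fun {g} hg =>
    (hev i).mul_bdd (c := 11 ^ p) (Measurable.aestronglyMeasurable (by fun_prop))
      (ae_of_all _ fun x => by
      rw [Real.norm_of_nonneg (truncWeight_nonneg _ _)]; exact truncWeight_le hp _)
  have hzero : ∫ x : Fin n → ℝ, x i * truncWeight p (vecVar (Function.update x i 0)) ∂Pn = 0 := by
    have h1 := (hind.comp measurable_id
      (by fun_prop : Measurable fun y : Fin n → ℝ => truncWeight p (vecVar y))).integral_fun_mul_eq_mul_integral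
      (Measurable.aestronglyMeasurable (measurable_pi_apply i))
      (Measurable.aestronglyMeasurable (by fun_prop))
    simp only [Function.comp_apply, id] at h1
    rw [h1, integral_comp_eval (μ := fun _ => Q) (f := fun y : ℝ => y) (by fun_prop),
      h.integral_id, zero_mul]
  have hm'I : Integrable (fun x : Fin n → ℝ => |vecMean (Function.update x i 0)|) Pn ∧
      ∫ x : Fin n → ℝ, |vecMean (Function.update x i 0)| ∂Pn ≤ 1 := by
    have hle : ∀ x : Fin n → ℝ, |vecMean (Function.update x i 0)| ≤ (∑ j, |x j|) / n := by
      intro x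
      unfold vecMean
      rw [abs_div, abs_of_pos hn']
      gcongr
      refine (Finset.abs_sum_le_sum_abs _ _).trans (Finset.sum_le_sum fun j _ => ?_)
      by_cases hj : j = i
      · subst hj; simp
      · simp [hj]
    have hg : Integrable (fun x : Fin n → ℝ => (∑ j, |x j|) / n) Pn :=
      (integrable_finsetSum _ fun j _ => (hev j).abs).div_const _
    refine ⟨hg.mono' (Measurable.aestronglyMeasurable (by fun_prop)) (ae_of_all _ fun x => by
      rw [Real.norm_eq_abs, abs_abs]; exact hle x), ?_⟩
    refine (integral_mono_of_nonneg (ae_of_all _ fun x => abs_nonneg _) hg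
      (ae_of_all _ hle)).trans ?_
    rw [integral_div, integral_finsetSum _ fun j _ => (hev j).abs]
    have : ∀ j, ∫ x : Fin n → ℝ, |x j| ∂Pn ≤ 1 := fun j => by
      rw [integral_comp_eval (μ := fun _ => Q) (f := fun y : ℝ => |y|) (by fun_prop)]
      exact h.integral_abs_le
    rw [div_le_one hn']
    refine (Finset.sum_le_sum fun j _ => this j).trans_eq (by simp)
  have hind2 := hind.comp (by fun_prop : Measurable fun t : ℝ => t ^ 2)
    (by fun_prop : Measurable fun y : Fin n → ℝ => |vecMean y|)
  have hcrossI : Integrable (fun x : Fin n → ℝ =>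
      x i ^ 2 * |vecMean (Function.update x i 0)|) Pn :=
    hind2.integrable_mul (hev2 i) hm'I.1
  have hcross : ∫ x : Fin n → ℝ, x i ^ 2 * |vecMean (Function.update x i 0)| ∂Pn ≤ 1 := by
    have h1 := hind2.integral_fun_mul_eq_mul_integral (hev2 i).aestronglyMeasurable
      hm'I.1.aestronglyMeasurable
    simp only [Function.comp_apply] at h1
    rw [h1, integral_comp_eval (μ := fun _ => Q) (f := fun y : ℝ => y ^ 2) (by fun_prop),
      h.integral_sq, one_mul]
    exact hm'I.2
  have hminI : Integrable (fun y : ℝ => |y| * min 1 (y ^ 2 / n)) Q :=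
    h.integrable.abs.mono' (Measurable.aestronglyMeasurable (by fun_prop)) (ae_of_all _ fun y => by
      rw [Real.norm_of_nonneg (by positivity)]
      exact mul_le_of_le_one_right (abs_nonneg y) (min_le_left _ _))
  have hminI' : Integrable (fun x : Fin n → ℝ => |x i| * min 1 (x i ^ 2 / n)) Pn :=
    integrable_comp_eval (μ := fun _ => Q) (f := fun y : ℝ => |y| * min 1 (y ^ 2 / n)) hminI
  have hpt : ∀ x : Fin n → ℝ, |x i * truncWeight p (vecVar x) -
      x i * truncWeight p (vecVar (Function.update x i 0))| ≤
      K * (|x i| * min 1 (x i ^ 2 / n) +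
        2 / n * (x i ^ 2 * |vecMean (Function.update x i 0)|)) := by
    intro x
    rw [← mul_sub, abs_mul]
    have h1 := abs_truncWeight_sub_le hp (vecVar_nonneg x) (vecVar_nonneg (Function.update x i 0))
    have h2 := abs_vecVar_sub_update_le hn x i
    set D := |vecVar x - vecVar (Function.update x i 0)|
    set t := 2 / n * (|x i| * |vecMean (Function.update x i 0)|) with ht
    have ht0 : 0 ≤ t := by positivity
    -- Only the quadratic term needs the cap: the cross term, times `|x i|`, is integrable with just
    -- a second moment.
    have h3 : min 1 D ≤ min 1 (x i ^ 2 / n) + t := by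
      refine (min_le_min_left 1 h2).trans ?_
      rcases min_cases (1 : ℝ) (x i ^ 2 / n) with ⟨e, _⟩ | ⟨e, _⟩
      · rw [e]; exact (min_le_left _ _).trans (by linarith)
      · rw [e]; exact min_le_right _ _
    calc |x i| * _ ≤ |x i| * (K * min 1 D) := by gcongr
      _ ≤ |x i| * (K * (min 1 (x i ^ 2 / n) + t)) := by gcongr
      _ = K * (|x i| * min 1 (x i ^ 2 / n) + 2 / n * (|x i| ^ 2 *
        |vecMean (Function.update x i 0)|)) := by rw [ht]; ring
      _ = _ := by rw [sq_abs]
  have hrI := (hminI'.add (hcrossI.const_mul (2 / (n : ℝ)))).const_mul K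
  have hdiff : ∫ x : Fin n → ℝ, x i * truncWeight p (vecVar x) ∂Pn =
      ∫ x : Fin n → ℝ, (x i * truncWeight p (vecVar x) -
      x i * truncWeight p (vecVar (Function.update x i 0))) ∂Pn := by
    rw [integral_sub (hbd measurable_vecVar) (hbd (by fun_prop)), hzero, sub_zero]
  rw [hdiff]
  refine (abs_integral_le_integral_abs).trans ?_
  refine (integral_mono_of_nonneg (ae_of_all _ fun x => abs_nonneg _) hrI
    (ae_of_all _ hpt)).trans ?_
  rw [integral_const_mul]
  refine mul_le_mul_of_nonneg_left ?_ hK0.le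
  simp only [Pi.add_apply]
  rw [integral_add hminI' (hcrossI.const_mul _), integral_const_mul,
    integral_comp_eval (μ := fun _ => Q) (f := fun y : ℝ => |y| * min 1 (y ^ 2 / n))
      hminI.aestronglyMeasurable]
  have : (0 : ℝ) ≤ 2 / n := by positivity
  nlinarith

lemma IsStandard.integral_vecMean_sq_le (h : IsStandard Q) (hn : 0 < n) :
    Integrable (fun x : Fin n → ℝ => vecMean x ^ 2) (Measure.pi fun _ => Q) ∧
      ∫ x : Fin n → ℝ, vecMean x ^ 2 ∂(Measure.pi fun _ => Q) ≤ 1 := by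
  have hn' : (0 : ℝ) < n := by exact_mod_cast hn
  have hev2 : ∀ j, Integrable (fun x : Fin n → ℝ => x j ^ 2) (Measure.pi fun _ => Q) := fun j =>
    integrable_comp_eval (μ := fun _ => Q) (f := fun y : ℝ => y ^ 2) h.integrable_sq
  have hle : ∀ x : Fin n → ℝ, vecMean x ^ 2 ≤ (∑ j, x j ^ 2) / n := by
    intro x
    rw [le_div_iff₀ hn', sum_sq_eq hn.ne']
    have := mul_nonneg hn'.le (vecVar_nonneg x)
    linarith
  have hg : Integrable (fun x : Fin n → ℝ => (∑ j, x j ^ 2) / n) (Measure.pi fun _ => Q) :=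
    (integrable_finsetSum _ fun j _ => hev2 j).div_const _
  refine ⟨hg.mono' (Measurable.aestronglyMeasurable (by fun_prop)) (ae_of_all _ fun x => by
    rw [Real.norm_of_nonneg (sq_nonneg _)]; exact hle x), ?_⟩
  refine (integral_mono_of_nonneg (ae_of_all _ fun x => sq_nonneg _) hg
    (ae_of_all _ hle)).trans ?_
  rw [integral_div, integral_finsetSum _ fun j _ => hev2 j, div_le_one hn']
  refine le_of_eq ?_
  have : ∀ j, ∫ x : Fin n → ℝ, x j ^ 2 ∂(Measure.pi fun _ => Q) = 1 := fun j => by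
    rw [integral_comp_eval (μ := fun _ => Q) (f := fun y : ℝ => y ^ 2) (by fun_prop),
      h.integral_sq]
  simp [this]

/-- The bias of the weighted block mean. -/
lemma IsStandard.abs_integral_score_le (h : IsStandard Q) (hp : 1 ≤ p) (hn : 0 < n) {c : ℝ}
    (hbad : (Measure.pi fun _ : Fin n => Q).real {x | ¬ IsGood x} ≤ Real.exp (-(c * n))) :
    |∫ x, score p x ∂(Measure.pi fun _ : Fin n => Q)| ≤ p * 11 ^ (p + 2) * biasRate Q c n := by
  have hn' : (0 : ℝ) < n := by exact_mod_cast hn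
  set Pn := Measure.pi fun _ : Fin n => Q with hPn
  set K : ℝ := p * 11 ^ (p + 2) with hK
  set t := Real.exp (-(c * n) / 2) with ht
  have ht0 : 0 < t := Real.exp_pos _
  have htt : Real.exp (-(c * n)) = t * t := by rw [ht, ← Real.exp_add]; congr 1; ring
  rw [htt] at hbad
  obtain ⟨hmI, hm1⟩ := h.integral_vecMean_sq_le hn
  have hev : ∀ j, Integrable (fun x : Fin n → ℝ => x j) Pn := fun j =>
    integrable_comp_eval (μ := fun _ => Q) (f := fun y : ℝ => y) h.integrable
  set B := {x : Fin n → ℝ | ¬ IsGood x} with hB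
  have hBm : MeasurableSet B := (measurableSet_isGood (n := n)).compl
  have hxI : ∀ j, Integrable (fun x : Fin n → ℝ => x j * truncWeight p (vecVar x)) Pn := fun j =>
    (hev j).mul_bdd (c := 11 ^ p) (Measurable.aestronglyMeasurable (by fun_prop))
      (ae_of_all _ fun x => by
        rw [Real.norm_of_nonneg (truncWeight_nonneg _ _)]; exact truncWeight_le hp _)
  have hmean : ∀ x : Fin n → ℝ, vecMean x * truncWeight p (vecVar x) =
      (∑ j, x j * truncWeight p (vecVar x)) / n := by
    intro x; rw [← Finset.sum_mul, vecMean]; ring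
  have hmtI : Integrable (fun x : Fin n → ℝ => vecMean x * truncWeight p (vecVar x)) Pn := by
    simp only [hmean]
    exact (integrable_finsetSum _ fun j _ => hxI j).div_const _
  -- The truncation is inactive on good blocks, so the two weights differ only on `B`.
  have hsplit : ∀ x : Fin n → ℝ, score p x = vecMean x * truncWeight p (vecVar x) -
      B.indicator (fun x => vecMean x * truncWeight p (vecVar x)) x := by
    intro x
    by_cases hx : IsGood x
    · rw [score, Set.indicator_of_mem (by exact hx), Set.indicator_of_notMem (by simpa [hB] using hx),
        sub_zero, truncWeight, max_eq_left (by exact hx.1)]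
      rw [mul_one_div]; rfl
    · rw [score, Set.indicator_of_notMem (by exact hx), Set.indicator_of_mem (by exact hx), sub_self]
  simp only [hsplit]
  rw [integral_sub hmtI (hmtI.indicator hBm)]
  have h1 : |∫ x, vecMean x * truncWeight p (vecVar x) ∂Pn| ≤
      K * (∫ x, |x| * min 1 (x ^ 2 / n) ∂Q + 2 / n) := by
    simp only [hmean]
    rw [integral_div, integral_finsetSum _ fun j _ => hxI j, abs_div, abs_of_pos hn',
      div_le_iff₀ hn']
    refine (Finset.abs_sum_le_sum_abs _ _).trans ((Finset.sum_le_sum fun j _ =>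
      h.abs_integral_mul_truncWeight_le hp hn j).trans_eq ?_)
    rw [Finset.sum_const, Finset.card_univ, Fintype.card_fin, nsmul_eq_mul]
    ring
  have h2 : |∫ x, B.indicator (fun x => vecMean x * truncWeight p (vecVar x)) x ∂Pn| ≤ K * t := by
    have hpt : ∀ x, |B.indicator (fun x => vecMean x * truncWeight p (vecVar x)) x| ≤
        11 ^ p * (t / 2 * vecMean x ^ 2 + B.indicator (fun _ => 1) x / (2 * t)) := by
      intro x
      by_cases hx : x ∈ B
      · rw [Set.indicator_of_mem hx, Set.indicator_of_mem hx, abs_mul,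
          abs_of_nonneg (truncWeight_nonneg _ _), mul_comm]
        -- Cauchy-Schwarz in AM-GM form: `B` has probability at most `t²` and the mean has second
        -- moment at most one, so the two terms integrate to at most `t`.
        have h3 : |vecMean x| ≤ t / 2 * vecMean x ^ 2 + 1 / (2 * t) := by
          have h4 : 0 ≤ (t * |vecMean x| - 1) ^ 2 / (2 * t) := by positivity
          have h5 : (t * |vecMean x| - 1) ^ 2 / (2 * t) =
              t / 2 * |vecMean x| ^ 2 + 1 / (2 * t) - |vecMean x| := by
            field_simp; ring
          rw [sq_abs] at h5
          linarith
        exact mul_le_mul (truncWeight_le hp _) h3 (abs_nonneg _) (by positivity)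
      · rw [Set.indicator_of_notMem hx, abs_zero]
        have : 0 ≤ B.indicator (fun _ => (1 : ℝ)) x := Set.indicator_nonneg (fun _ _ => zero_le_one) _
        positivity
    have hi1 : Integrable (B.indicator fun _ => (1 : ℝ)) Pn := (integrable_const _).indicator hBm
    have hgI : Integrable (fun x => 11 ^ p * (t / 2 * vecMean x ^ 2 +
        B.indicator (fun _ => 1) x / (2 * t))) Pn :=
      ((hmI.const_mul _).add (hi1.div_const _)).const_mul _
    refine abs_integral_le_integral_abs.trans ((integral_mono_of_nonneg
      (ae_of_all _ fun x => abs_nonneg _) hgI (ae_of_all _ hpt)).trans ?_)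
    rw [integral_const_mul, integral_add (hmI.const_mul _) (hi1.div_const _), integral_const_mul,
      integral_div, integral_indicator hBm]
    simp only [integral_const, measureReal_restrict_apply_univ, smul_eq_mul, mul_one]
    have h6 : Pn.real B / (2 * t) ≤ t / 2 := by
      rw [div_le_iff₀ (by positivity)]; nlinarith
    have h7 : t / 2 * ∫ x, vecMean x ^ 2 ∂Pn ≤ t / 2 * 1 := by gcongr
    have h8 : (11 : ℝ) ^ p ≤ K := by
      have h9 : (11 : ℝ) ^ p ≤ 11 ^ (p + 2) :=
        Real.rpow_le_rpow_of_exponent_le (by norm_num) (by linarith)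
      have : (0 : ℝ) < 11 ^ (p + 2) := by positivity
      nlinarith
    calc _ ≤ 11 ^ p * t := by gcongr; linarith
      _ ≤ K * t := by gcongr
  unfold biasRate
  calc _ ≤ _ := abs_sub _ _
    _ ≤ K * (∫ x, |x| * min 1 (x ^ 2 / n) ∂Q + 2 / n) + K * t := add_le_add h1 h2
    _ = _ := by rw [ht]; ring

end Bias

/-! ### Asymptotic size of the bias rate under the `1 + δ` moment. -/

section Rate

variable {n : ℕ} {Q : Measure ℝ}

lemma min_one_sq_le_rpow {δ y : ℝ} (h0 : 0 ≤ δ) (h2 : δ ≤ 2) (hy : 0 ≤ y) :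
    min 1 (y ^ 2) ≤ y ^ δ := by
  rcases le_total 1 y with h | h
  · exact (min_le_left _ _).trans (Real.one_le_rpow h h0)
  · refine (min_le_right _ _).trans ?_
    rcases hy.eq_or_lt with rfl | hy'
    · simpa using Real.rpow_nonneg le_rfl δ
    · rw [← Real.rpow_two]
      exact Real.rpow_le_rpow_of_exponent_ge hy' h h2

lemma abs_mul_min_le {δ : ℝ} (h0 : 0 ≤ δ) (h2 : δ ≤ 2) (hn : 0 < n) (x : ℝ) :
    |x| * min 1 (x ^ 2 / n) ≤ (n : ℝ) ^ (-δ / 2) * |x| ^ (1 + δ) := by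
  have hn' : (0 : ℝ) < n := by exact_mod_cast hn
  have h1 : x ^ 2 / n = (|x| / √n) ^ 2 := by
    rw [div_pow, sq_abs, Real.sq_sqrt hn'.le]
  rcases (abs_nonneg x).eq_or_lt with hx | hx
  · rw [← hx, zero_mul]; positivity
  rw [h1, Real.rpow_add hx, Real.rpow_one]
  have h3 := min_one_sq_le_rpow h0 h2 (show 0 ≤ |x| / √n by positivity)
  have h4 : (|x| / √n) ^ δ = (n : ℝ) ^ (-δ / 2) * |x| ^ δ := by
    rw [Real.div_rpow hx.le (Real.sqrt_nonneg _), Real.sqrt_eq_rpow, ← Real.rpow_mul hn'.le,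
      neg_div, Real.rpow_neg hn'.le, show 1 / 2 * δ = δ / 2 by ring, div_eq_inv_mul]
  calc _ ≤ |x| * (|x| / √n) ^ δ := by gcongr
    _ = _ := by rw [h4]; ring

/-- Dominated convergence: after division by `n ^ (-δ / 2)` the integrand is at most `|x| ^ (1 +
δ)`, and pointwise at most `|x|³ n ^ (-(1 - δ / 2))`, which vanishes because `δ < 2`. -/
lemma isLittleO_integral_abs_mul_min {δ : ℝ} (h1 : 1 ≤ δ) (h2 : δ < 2)
    (hI : Integrable (fun x : ℝ => |x| ^ (1 + δ)) Q) :
    (fun n : ℕ => ∫ x, |x| * min 1 (x ^ 2 / n) ∂Q) =o[atTop] fun n : ℕ => (n : ℝ) ^ (-δ / 2) := by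
  have hinv : ∀ n : ℕ, 0 < n → ((n : ℝ) ^ (-δ / 2))⁻¹ = (n : ℝ) ^ (δ / 2) := by
    intro n hn
    rw [← Real.rpow_neg (Nat.cast_nonneg n)]; congr 1; ring
  refine isLittleO_of_tendsto' ?_ ?_
  · filter_upwards [eventually_gt_atTop 0] with n hn h
    have : (0 : ℝ) < n := by exact_mod_cast hn
    exact absurd h (Real.rpow_pos_of_pos this _).ne'
  have hlim : Tendsto (fun n : ℕ => ∫ x, (|x| * min 1 (x ^ 2 / n)) / (n : ℝ) ^ (-δ / 2) ∂Q) atTop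
      (nhds (∫ _, (0 : ℝ) ∂Q)) := by
    refine tendsto_integral_filter_of_dominated_convergence _
      (Eventually.of_forall fun n => Measurable.aestronglyMeasurable (by fun_prop)) ?_ hI ?_
    · filter_upwards [eventually_gt_atTop 0] with n hn
      refine ae_of_all _ fun x => ?_
      have hn' : (0 : ℝ) < n := by exact_mod_cast hn
      rw [Real.norm_of_nonneg (by positivity), div_le_iff₀ (by positivity), mul_comm]
      rw [mul_comm]
      exact (abs_mul_min_le (by linarith) h2.le hn x).trans_eq (mul_comm _ _)
    · refine ae_of_all _ fun x => ?_
      have hup : Tendsto (fun n : ℕ => |x| * x ^ 2 * (n : ℝ) ^ (-(1 - δ / 2))) atTop (nhds 0) := by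
        have := ((tendsto_rpow_neg_atTop (show 0 < 1 - δ / 2 by linarith)).comp
          tendsto_natCast_atTop_atTop).const_mul (|x| * x ^ 2)
        simpa using this
      refine squeeze_zero' (Eventually.of_forall fun n => by positivity) ?_ hup
      filter_upwards [eventually_gt_atTop 0] with n hn
      have hn' : (0 : ℝ) < n := by exact_mod_cast hn
      rw [div_eq_mul_inv, hinv n hn]
      calc _ ≤ |x| * (x ^ 2 / n) * (n : ℝ) ^ (δ / 2) := by gcongr; exact min_le_right _ _
        _ = |x| * x ^ 2 * ((n : ℝ) ^ (-1 : ℝ) * (n : ℝ) ^ (δ / 2)) := by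
            rw [Real.rpow_neg_one]; ring
        _ = _ := by rw [← Real.rpow_add hn']; congr 2; ring
  simpa only [integral_div, integral_zero] using hlim

lemma isLittleO_exp_neg_natCast {c : ℝ} (hc : 0 < c) (b : ℝ) :
    (fun n : ℕ => Real.exp (-(c * n) / 2)) =o[atTop] fun n : ℕ => (n : ℝ) ^ b := by
  have := (isLittleO_exp_neg_mul_rpow_atTop (half_pos hc) b).comp_tendsto
    (tendsto_natCast_atTop_atTop (R := ℝ))
  refine this.congr_left fun n => ?_
  simp only [Function.comp_apply]
  congr 1; ring

lemma isLittleO_biasRate {δ c : ℝ} (hc : 0 < c) (h1 : 1 ≤ δ) (h2 : δ < 2)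
    (hI : Integrable (fun x : ℝ => |x| ^ (1 + δ)) Q) :
    biasRate Q c =o[atTop] fun n : ℕ => (n : ℝ) ^ (-δ / 2) := by
  refine ((isLittleO_integral_abs_mul_min h1 h2 hI).add ?_).add (isLittleO_exp_neg_natCast hc _)
  have h3 := (isLittleO_one_iff ℝ).2 ((tendsto_rpow_neg_atTop (show 0 < 1 - δ / 2 by linarith)).comp
    (tendsto_natCast_atTop_atTop (R := ℝ)))
  have h4 := ((isBigO_refl (fun n : ℕ => (n : ℝ) ^ (-δ / 2)) atTop).mul_isLittleO h3).const_mul_left 2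
  simp only [mul_one] at h4
  refine h4.congr' ?_ EventuallyEq.rfl
  filter_upwards [eventually_gt_atTop 0] with n hn
  have hn' : (0 : ℝ) < n := by exact_mod_cast hn
  rw [Function.comp_apply, ← Real.rpow_add hn', show -δ / 2 + -(1 - δ / 2) = -1 by ring,
    Real.rpow_neg_one, div_eq_mul_inv]

lemma isBigO_biasRate {c : ℝ} (hc : 0 < c) (hI : Integrable (fun x : ℝ => |x| ^ (1 + 2 : ℝ)) Q) :
    biasRate Q c =O[atTop] fun n : ℕ => (n : ℝ)⁻¹ := by
  have hrp : ∀ n : ℕ, (n : ℝ) ^ (-1 : ℝ) = (n : ℝ)⁻¹ := fun n => Real.rpow_neg_one _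
  refine (IsBigO.add ?_ ?_).add ?_
  · refine IsBigO.of_bound (∫ x, |x| ^ (1 + 2 : ℝ) ∂Q) ?_
    filter_upwards [eventually_gt_atTop 0] with n hn
    rw [Real.norm_of_nonneg (integral_nonneg fun x => by positivity),
      Real.norm_of_nonneg (by positivity), mul_comm, ← integral_const_mul]
    refine integral_mono_of_nonneg (ae_of_all _ fun x => by positivity) (hI.const_mul _)
      (ae_of_all _ fun x => ?_)
    have := abs_mul_min_le (δ := 2) (by norm_num) le_rfl hn x
    rwa [show (-2 / 2 : ℝ) = -1 by norm_num, hrp] at this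
  · refine (isBigO_refl _ _).const_mul_left 2 |>.congr_left fun n => ?_
    rw [div_eq_mul_inv]
  · have := (isLittleO_exp_neg_natCast hc (-1)).isBigO
    simpa only [hrp] using this

end Rate

/-! ### Standardisation of a law -/

section Standardise

/-- The law of the standardised variable. -/
noncomputable def standardLaw (P : Measure ℝ) : Measure ℝ :=
  P.map fun x => (x - mean P) / sd P

lemma integral_sq_sub_mean (P : Measure ℝ) : ∫ x, (x - mean P) ^ 2 ∂P = sd P ^ 2 := by
  rw [sd, Real.sq_sqrt (variance_nonneg _ _), variance_eq_integral (by fun_prop)]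
  rfl

variable {P : Measure ℝ}

lemma integrable_standardLaw_rpow {q : ℝ} (h : 0 < sd P)
    (hI : Integrable (fun x : ℝ => |x - mean P| ^ q) P) :
    Integrable (fun x : ℝ => |x| ^ q) (standardLaw P) := by
  rw [standardLaw, integrable_map_measure (Measurable.aestronglyMeasurable (by fun_prop))
    (by fun_prop)]
  refine (hI.div_const (sd P ^ q)).congr (ae_of_all _ fun x => ?_)
  simp only [Function.comp_apply]
  rw [abs_div, abs_of_pos h, Real.div_rpow (abs_nonneg _) h.le]

variable [IsProbabilityMeasure P]

instance : IsProbabilityMeasure (standardLaw P) :=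
  Measure.isProbabilityMeasure_map (by fun_prop)

/-- An infinite variance has real value zero by convention, so `0 < sd P` already encodes `σ < ∞`.
-/
lemma memLp_two_of_sd_pos (h : 0 < sd P) : MemLp (fun x : ℝ => x) 2 P := by
  by_contra hcon
  rw [sd, variance_of_not_memLp (by fun_prop) hcon, Real.sqrt_zero] at h
  exact lt_irrefl _ h

lemma integrable_sq_sub_mean (h : 0 < sd P) : Integrable (fun x => (x - mean P) ^ 2) P :=
  ((memLp_two_of_sd_pos h).sub (memLp_const _)).integrable_sq

lemma isStandard_standardLaw (h : 0 < sd P) : IsStandard (standardLaw P) where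
  integrable_sq := by
    rw [standardLaw, integrable_map_measure (by fun_prop) (by fun_prop)]
    refine ((integrable_sq_sub_mean h).div_const (sd P ^ 2)).congr (ae_of_all _ fun x => ?_)
    simp [div_pow]
  integral_id := by
    rw [standardLaw, integral_map (by fun_prop) (by fun_prop), integral_div,
      integral_sub ((memLp_two_of_sd_pos h).integrable (by norm_num)) (integrable_const _)]
    simp [mean]
  integral_sq := by
    rw [standardLaw, integral_map (by fun_prop) (by fun_prop)]
    simp only [div_pow]
    rw [integral_div, integral_sq_sub_mean]
    field_simp

lemma exists_truncation_level (h : 0 < sd P) :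
    ∃ a : ℝ, 0 < a ∧
      sd P ^ 2 / 2 ≤ ∫ x in {x : ℝ | |x - mean P| ≤ sd P * a}, |x - mean P| ^ 2 ∂P := by
  set s : ℕ → Set ℝ := fun m => {x : ℝ | |x - mean P| ≤ sd P * m} with hs
  have hsm : ∀ m, MeasurableSet (s m) := fun m => measurableSet_le (by fun_prop) (by fun_prop)
  have hmono : Monotone s := fun a b hab x (hx : |x - mean P| ≤ sd P * a) =>
    (hx.trans (by gcongr) : |x - mean P| ≤ sd P * b)
  have hU : ⋃ m, s m = Set.univ := by
    refine Set.eq_univ_of_forall fun x => Set.mem_iUnion.2 ?_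
    obtain ⟨m, hm⟩ := exists_nat_ge (|x - mean P| / sd P)
    refine ⟨m, ?_⟩
    rw [div_le_iff₀ h] at hm
    exact hm.trans_eq (mul_comm _ _)
  have hlim := tendsto_setIntegral_of_monotone hsm hmono
    (f := fun x => |x - mean P| ^ 2) (μ := P) (by
      simp only [sq_abs]; exact (integrable_sq_sub_mean h).integrableOn)
  rw [hU, setIntegral_univ] at hlim
  simp only [sq_abs] at hlim ⊢
  rw [integral_sq_sub_mean] at hlim
  have hlt : sd P ^ 2 / 2 < sd P ^ 2 := half_lt_self (by positivity)
  obtain ⟨m, hm, hm0⟩ := ((hlim.eventually (lt_mem_nhds hlt)).and (eventually_gt_atTop 0)).exists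
  exact ⟨m, by exact_mod_cast hm0, hm.le⟩

/-- The margin in `zeta P + 1` provides an admissible level without asking whether the infimum is
attained. The maximum with `2` meets the requirement `2 ≤ a` of the pair estimates. -/
lemma half_le_setIntegral_standardLaw (h : 0 < sd P) :
    1 / 2 ≤ ∫ x in {x : ℝ | |x| ≤ max (zeta P + 1) 2}, x ^ 2 ∂(standardLaw P) := by
  obtain ⟨b, ⟨hb0, hb⟩, hlt⟩ := exists_lt_of_csInf_lt (exists_truncation_level h)
    (show zeta P < zeta P + 1 by linarith)
  have hba : b ≤ max (zeta P + 1) 2 := hlt.le.trans (le_max_left _ _)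
  rw [standardLaw, setIntegral_map (measurableSet_abs_le _) (by fun_prop) (by fun_prop)]
  simp only [div_pow]
  rw [integral_div, le_div_iff₀ (by positivity)]
  simp only [sq_abs] at hb
  refine le_trans (by linarith) (hb.trans ?_)
  refine setIntegral_mono_set (integrable_sq_sub_mean h).integrableOn
    (ae_of_all _ fun x => sq_nonneg _) (ae_of_all _ fun x hx => ?_)
  have hx' : |x - mean P| ≤ sd P * b := hx
  change |(x - mean P) / sd P| ≤ max (zeta P + 1) 2
  rw [abs_div, abs_of_pos h, div_le_iff₀ h]
  nlinarith

end Standardise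

/-! ### Block statistics in terms of the standardised blocks -/

section Partition

variable {N k n : ℕ} {G : Fin k → Finset (Fin N)}

/-- Enumeration of the sample through the blocks of a partition. -/
def IsBlockPartition.index (hG : IsBlockPartition n G) (q : Fin k × Fin n) : Fin N :=
  (G q.1).orderEmbOfFin (hG.card q.1) q.2

lemma IsBlockPartition.index_mem (hG : IsBlockPartition n G) (q : Fin k × Fin n) :
    hG.index q ∈ G q.1 :=
  Finset.orderEmbOfFin_mem _ _ _

lemma IsBlockPartition.index_injective (hG : IsBlockPartition n G) :
    Function.Injective hG.index := by
  rintro ⟨j, i⟩ ⟨j', i'⟩ h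
  have h1 := hG.index_mem (j, i)
  have h2 := hG.index_mem (j', i')
  rw [h] at h1
  obtain rfl : j = j' := by
    by_contra hne
    exact Finset.disjoint_left.1 (hG.disjoint j j' hne) h1 h2
  obtain rfl : i = i' := ((G j).orderEmbOfFin (hG.card j)).injective h
  rfl

lemma IsBlockPartition.sum_block (hG : IsBlockPartition n G) (j : Fin k) (f : Fin N → ℝ) :
    ∑ i ∈ G j, f i = ∑ i : Fin n, f (hG.index (j, i)) := by
  conv_lhs => rw [← Finset.image_orderEmbOfFin_univ (G j) (hG.card j)]
  rw [Finset.sum_image fun a _ b _ h => ((G j).orderEmbOfFin (hG.card j)).injective h]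
  rfl

lemma IsBlockPartition.card_eq (hG : IsBlockPartition n G) : N = k * n := by
  have hsurj : Function.Surjective hG.index := by
    intro i
    obtain ⟨j, hj⟩ := hG.cover i
    rw [← Finset.image_orderEmbOfFin_univ (G j) (hG.card j), Finset.mem_image] at hj
    obtain ⟨l, -, hl⟩ := hj
    exact ⟨(j, l), hl⟩
  have := Fintype.card_of_bijective ⟨hG.index_injective, hsurj⟩
  simpa using this.symm

variable {μ σ : ℝ}

lemma IsBlockPartition.blockMean_eq (hG : IsBlockPartition n G) (hn : 0 < n) (hσ : 0 < σ)
    (x : Fin N → ℝ) (j : Fin k) :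
    blockMean x (G j) = μ + σ * vecMean fun i => (x (hG.index (j, i)) - μ) / σ := by
  have hn' : (0 : ℝ) < n := by exact_mod_cast hn
  rw [blockMean, hG.sum_block, hG.card, vecMean, ← Finset.sum_div, Finset.sum_sub_distrib]
  simp only [Finset.sum_const, Finset.card_univ, Fintype.card_fin, nsmul_eq_mul]
  field_simp
  ring

lemma IsBlockPartition.blockSd_eq (hG : IsBlockPartition n G) (hn : 0 < n) (hσ : 0 < σ)
    (x : Fin N → ℝ) (j : Fin k) :
    blockSd x (G j) = σ * vecSd fun i => (x (hG.index (j, i)) - μ) / σ := by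
  have h : ∀ i, x (hG.index (j, i)) - blockMean x (G j) =
      σ * ((x (hG.index (j, i)) - μ) / σ - vecMean fun i => (x (hG.index (j, i)) - μ) / σ) := by
    intro i
    rw [hG.blockMean_eq hn hσ (μ := μ)]
    field_simp
    ring
  rw [blockSd, hG.sum_block, hG.card, vecSd, vecVar]
  simp only [h, mul_pow]
  rw [← Finset.mul_sum, mul_div_assoc, Real.sqrt_mul (sq_nonneg σ), Real.sqrt_sq hσ.le]

/-- With all block deviations positive no term is infinite, so the event can be read in the reals,
where `σ ^ p` cancels. -/
lemma natCast_le_of_harmonicMeanEvent (hk : 0 < k) {p : ℝ} (hσ : 0 < σ) {x : Fin N → ℝ}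
    {s : Fin k → ℝ} (hs : ∀ j, 0 < s j) (hsd : ∀ j, blockSd x (G j) = σ * s j)
    (hH : HarmonicMeanEvent σ p G x) : (k : ℝ) ≤ 4 ^ p * ∑ j, 1 / s j ^ p := by
  have hk' : (0 : ℝ) < k := by exact_mod_cast hk
  have hpos : ∀ j, 0 < (σ * s j) ^ p := fun j => Real.rpow_pos_of_pos (mul_pos hσ (hs j)) p
  have : Nonempty (Fin k) := ⟨⟨0, hk⟩⟩
  have hT : 0 < ∑ j, ((σ * s j) ^ p)⁻¹ :=
    Finset.sum_pos (fun j _ => inv_pos.2 (hpos j)) Finset.univ_nonempty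
  have hH' : harmonicMean p G x ≤ ENNReal.ofReal ((4 * σ) ^ p) := hH
  have he : harmonicMean p G x = ENNReal.ofReal (((k : ℝ)⁻¹ * ∑ j, ((σ * s j) ^ p)⁻¹)⁻¹) := by
    have hterm : ∀ j, (ENNReal.ofReal (blockSd x (G j) ^ p))⁻¹ =
        ENNReal.ofReal ((σ * s j) ^ p)⁻¹ := fun j => by
      rw [hsd, ENNReal.ofReal_inv_of_pos (hpos j)]
    simp only [harmonicMean, hterm]
    rw [ENNReal.ofReal_inv_of_pos (by positivity), ENNReal.ofReal_mul (by positivity),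
      ENNReal.ofReal_inv_of_pos hk', ENNReal.ofReal_natCast,
      ENNReal.ofReal_sum_of_nonneg fun j _ => (inv_pos.2 (hpos j)).le]
  rw [he, ENNReal.ofReal_le_ofReal_iff (by positivity), inv_le_iff_one_le_mul₀ (by positivity)] at hH'
  have hsum : ∑ j, ((σ * s j) ^ p)⁻¹ = (σ ^ p)⁻¹ * ∑ j, 1 / s j ^ p := by
    rw [Finset.mul_sum]
    refine Finset.sum_congr rfl fun j _ => ?_
    rw [Real.mul_rpow hσ.le (hs j).le, mul_inv, one_div]
  rw [hsum, Real.mul_rpow (by norm_num) hσ.le] at hH'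
  have hσp : 0 < σ ^ p := Real.rpow_pos_of_pos hσ p
  have : 4 ^ p * σ ^ p * ((k : ℝ)⁻¹ * ((σ ^ p)⁻¹ * ∑ j, 1 / s j ^ p)) =
      (4 ^ p * ∑ j, 1 / s j ^ p) / k := by
    field_simp
  rw [this, le_div_iff₀ hk', one_mul] at hH'
  exact hH'

lemma estimator_sub_eq (hk : 0 < k) {p : ℝ} (hσ : 0 < σ) {x : Fin N → ℝ} {m s : Fin k → ℝ}
    (hs : ∀ j, 0 < s j) (hsd : ∀ j, blockSd x (G j) = σ * s j)
    (hm : ∀ j, blockMean x (G j) = μ + σ * m j) :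
    estimator p G x - μ = σ * (∑ j, m j / s j ^ p) / ∑ j, 1 / s j ^ p := by
  have : Nonempty (Fin k) := ⟨⟨0, hk⟩⟩
  have hsp : ∀ j, 0 < s j ^ p := fun j => Real.rpow_pos_of_pos (hs j) p
  have hT : 0 < ∑ j, 1 / s j ^ p :=
    Finset.sum_pos (fun j _ => one_div_pos.2 (hsp j)) Finset.univ_nonempty
  have hσp : 0 < σ ^ p := Real.rpow_pos_of_pos hσ p
  have hw : ∀ j, weight p G x j = (1 / s j ^ p) / ∑ i, 1 / s i ^ p := by
    intro j
    have h1 : ∀ i, 1 / blockSd x (G i) ^ p = (σ ^ p)⁻¹ * (1 / s i ^ p) := by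
      intro i
      rw [hsd, Real.mul_rpow hσ.le (hs i).le, one_div, mul_inv, one_div]
    simp only [weight, h1]
    rw [← Finset.mul_sum, mul_div_mul_left _ _ (inv_pos.2 hσp).ne']
  simp only [estimator, hw, hm, mul_add]
  rw [Finset.sum_add_distrib, ← Finset.sum_mul, ← Finset.sum_div, div_self hT.ne', one_mul,
    add_sub_cancel_left, Finset.mul_sum, Finset.sum_div]
  refine Finset.sum_congr rfl fun j _ => ?_
  ring

/-- The deterministic part of the error bound. -/
lemma abs_estimator_sub_le (hk : 0 < k) (hn : 0 < n) (hN : N = k * n) {p : ℝ} (hp : 1 ≤ p)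
    (hσ : 0 < σ) {x : Fin N → ℝ} {V : Fin k → Fin n → ℝ} (hV : ∀ j, IsGood (V j))
    (hsd : ∀ j, blockSd x (G j) = σ * vecSd (V j))
    (hm : ∀ j, blockMean x (G j) = μ + σ * vecMean (V j))
    (hH : HarmonicMeanEvent σ p G x) {b φ s : ℝ} (hs : 0 ≤ s)
    (hb : |b| ≤ p * 11 ^ (p + 2) * φ)
    (hdev : |∑ j, (score p (V j) - b)| ≤
      √(2 * k * (4 * (61 * (11 ^ p) ^ 2 / n)) * s)) :
    |estimator p G x - μ| ≤ 4 ^ p * (p * 11 ^ (p + 2)) * σ * (√((s + 1) / N) + φ) := by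
  have hk' : (0 : ℝ) < k := by exact_mod_cast hk
  have hn' : (0 : ℝ) < n := by exact_mod_cast hn
  have hpos : ∀ j, 0 < vecSd (V j) := fun j => lt_of_lt_of_le (by norm_num) (hV j).1
  have h1 := natCast_le_of_harmonicMeanEvent hk hσ hpos hsd hH
  rw [estimator_sub_eq hk hσ hpos hsd hm]
  set T := ∑ j, 1 / vecSd (V j) ^ p
  set L : ℝ := 11 ^ p with hL
  set F : ℝ := 4 ^ p with hF
  have hL0 : 0 < L := by positivity
  have hF0 : 0 < F := by positivity
  have hT : 0 < T := by
    by_contra! hT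
    nlinarith
  have hsc : ∀ j, vecMean (V j) / vecSd (V j) ^ p = score p (V j) := fun j => by
    rw [score, Set.indicator_of_mem (by exact hV j)]
  simp only [hsc]
  rw [Finset.sum_sub_distrib, Finset.sum_const, Finset.card_univ, Fintype.card_fin,
    nsmul_eq_mul] at hdev
  have hpow : (11 : ℝ) ^ (p + 2) = 121 * L := by
    rw [Real.rpow_add (by norm_num)]; norm_num; ring
  have hroot : √(2 * k * (4 * (61 * L ^ 2 / n)) * s) ≤ 121 * L * k * √((s + 1) / N) := by
    -- Since `N = k n`, `√(k s / n)` is `k √(s / N)`; the constants compare as `488 ≤ 121²`.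
    rw [Real.sqrt_le_left (by positivity), mul_pow, Real.sq_sqrt (by positivity), hN]
    push_cast
    have : (121 * L * k) ^ 2 * ((s + 1) / (k * n)) = 14641 * (L ^ 2 * k / n * (s + 1)) := by
      field_simp; ring
    rw [this]
    have h2 : 2 * k * (4 * (61 * L ^ 2 / n)) * s = 488 * (L ^ 2 * k / n * s) := by ring
    rw [h2]
    have h3 : 0 ≤ L ^ 2 * k / n := by positivity
    nlinarith
  have hroot0 : 0 ≤ √((s + 1) / N) := Real.sqrt_nonneg _
  rw [hpow] at hb ⊢
  have hS : |∑ j, score p (V j)| ≤ p * (121 * L) * k * (√((s + 1) / N) + φ) := by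
    have h4 : |∑ j, score p (V j)| ≤ |∑ j, score p (V j) - k * b| + |k * b| := by
      have := abs_add_le (∑ j, score p (V j) - k * b) (k * b)
      rwa [sub_add_cancel] at this
    rw [abs_mul, abs_of_pos hk'] at h4
    have h5 := mul_le_mul_of_nonneg_left hb hk'.le
    have h6 : 121 * L * k * √((s + 1) / N) ≤ p * (121 * L * k * √((s + 1) / N)) :=
      le_mul_of_one_le_left (by positivity) hp
    linarith [hdev.trans hroot]
  rw [abs_div, abs_mul, abs_of_pos hσ, abs_of_pos hT, div_le_iff₀ hT]
  have hX : 0 ≤ p * (121 * L) * k * (√((s + 1) / N) + φ) := (abs_nonneg _).trans hS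
  have hX' : 0 ≤ p * (121 * L) * (√((s + 1) / N) + φ) := by
    have : 0 ≤ k * (p * (121 * L) * (√((s + 1) / N) + φ)) := by linarith
    exact nonneg_of_mul_nonneg_right this hk'
  calc σ * |∑ j, score p (V j)| ≤ σ * (p * (121 * L) * k * (√((s + 1) / N) + φ)) := by gcongr
    _ = σ * (p * (121 * L) * (√((s + 1) / N) + φ)) * k := by ring
    _ ≤ σ * (p * (121 * L) * (√((s + 1) / N) + φ)) * (F * T) := by gcongr
    _ = _ := by ring

end Partition

/-! ### Union bound over the fluctuation event and the bad blocks. -/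

section Deviation

variable {N k n : ℕ} {G : Fin k → Finset (Fin N)} {Q : Measure ℝ} [IsProbabilityMeasure Q]
  {Ω : Type*} [MeasurableSpace Ω] {Pr : Measure Ω} [IsProbabilityMeasure Pr]

/-- Uniform control of all blocks of a standardised sample. -/
lemma IsStandard.measureReal_blocks_le (h : IsStandard Q) (hk : 0 < k) (hn : 0 < n) {p c s : ℝ}
    (hp : 1 ≤ p) (hs : 0 ≤ s)
    (hbad : (Measure.pi fun _ : Fin n => Q).real {x | ¬ IsGood x} ≤ Real.exp (-(c * n)))
    {Z : Fin k × Fin n → Ω → ℝ} (hZ : ∀ q, HasLaw (Z q) Q Pr) (hind : iIndepFun Z Pr) :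
    Pr.real ({ω | √(2 * k * (4 * (61 * (11 ^ p) ^ 2 / n)) * s) ≤
        |∑ j, (score p (fun i => Z (j, i) ω) -
          ∫ y, score p y ∂(Measure.pi fun _ : Fin n => Q))|} ∪
      ⋃ j, {ω | ¬ IsGood fun i => Z (j, i) ω}) ≤
      2 * Real.exp (-s) + k * Real.exp (-(c * n)) := by
  have hlaw : ∀ j, HasLaw (fun ω i => Z (j, i) ω) (Measure.pi fun _ : Fin n => Q) Pr := fun j =>
    (hind.precomp (g := fun i : Fin n => (j, i)) fun _ _ h => (Prod.mk.inj h).2).hasLaw_pi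
      fun i => hZ (j, i)
  have hV : iIndepFun (fun j ω i => Z (j, i) ω) Pr :=
    (iIndepFun_iff_hasLaw_pi_pi hlaw).2 (hasLaw_blocks hZ hind)
  set b := ∫ y, score p y ∂(Measure.pi fun _ : Fin n => Q)
  set C0 : NNReal := 4 * (61 * (11 ^ p) ^ 2 / n) with hC0
  have hC0' : (C0 : ℝ) = 4 * (61 * (11 ^ p) ^ 2 / n) := by
    rw [hC0]; push_cast; rfl
  have hC0pos : 0 < C0 := by
    have : (0 : NNReal) < n := by exact_mod_cast hn
    have : (0 : NNReal) < 11 ^ p := NNReal.rpow_pos (by norm_num)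
    positivity
  have hsub : ∀ j, HasSubgaussianMGF (fun ω => score p (fun i => Z (j, i) ω) - b) C0 Pr := by
    intro j
    have h1 := h.hasSubgaussianMGF_score hp hn
    rw [← (hlaw j).map_eq] at h1
    have h2 := h1.of_map (hlaw j).aemeasurable
    rw [(hlaw j).map_eq] at h2
    exact h2
  have hind2 : iIndepFun (fun j ω => score p (fun i => Z (j, i) ω) - b) Pr :=
    hV.comp (fun _ x => score p x - b) fun _ => by fun_prop
  have h1 := measureReal_abs_sum_ge_le hk hC0pos hind2 hsub hs
  rw [hC0'] at h1
  have h2 : Pr.real (⋃ j, {ω | ¬ IsGood fun i => Z (j, i) ω}) ≤ k * Real.exp (-(c * n)) := by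
    refine (measureReal_iUnion_fintype_le _).trans ?_
    have h3 : ∀ j, Pr.real {ω | ¬ IsGood fun i => Z (j, i) ω} ≤ Real.exp (-(c * n)) := fun j => by
      rw [(hlaw j).measureReal_eq (p := fun x => ¬ IsGood x) (measurableSet_isGood (n := n)).compl]
      exact hbad
    refine (Finset.sum_le_sum fun j _ => h3 j).trans_eq ?_
    simp
  exact (measureReal_union_le _ _).trans (add_le_add h1 h2)

end Deviation

end BlockMeans

theorem theorem1 :
    ∃ C c : ℝ → ℝ, (∀ p, 0 < C p) ∧ (∀ z, 0 < c z) ∧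
      ∀ (P : Measure ℝ) [IsProbabilityMeasure P] (δ : ℝ), 1 ≤ δ → δ ≤ 2 →
        0 < BlockMeans.sd P →
        Integrable (fun x : ℝ => |x - BlockMeans.mean P| ^ (1 + δ)) P →
        ∃ φ : ℕ → ℝ,
          (δ < 2 → φ =o[atTop] fun n : ℕ => (n : ℝ) ^ (-δ / 2)) ∧
          (δ = 2 → φ =O[atTop] fun n : ℕ => (n : ℝ)⁻¹) ∧
          ∀ (p : ℝ), 1 ≤ p →
          ∀ (N k n : ℕ), 0 < k → 2 ≤ n →
          ∀ (G : Fin k → Finset (Fin N)), BlockMeans.IsBlockPartition n G →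
          ∀ (Ω : Type*) [MeasurableSpace Ω] (Pr : Measure Ω) [IsProbabilityMeasure Pr]
            (X : Fin N → Ω → ℝ), (∀ i, HasLaw (X i) P Pr) → iIndepFun X Pr →
          ∀ s : ℝ, 0 ≤ s →
            1 - 2 * Real.exp (-s) - k * Real.exp (-(c (BlockMeans.zeta P) * n)) ≤
              Pr.real {ω | BlockMeans.HarmonicMeanEvent (BlockMeans.sd P) p G (fun i => X i ω) →
                (∀ j, 0 < BlockMeans.blockSd (fun i => X i ω) (G j)) ∧
                |BlockMeans.estimator p G (fun i => X i ω) - BlockMeans.mean P| ≤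
                  C p * BlockMeans.sd P * (√((s + 1) / N) + φ n)} := by
  choose c hc hcQ using fun z : ℝ =>
    BlockMeans.exists_rate_not_isGood (le_max_right (z + 1) (2 : ℝ))
  -- The maximum makes the constant positive for every real `p`; it equals `p` in the range `p ≥ 1`.
  refine ⟨fun p => 4 ^ p * (max p 1 * 11 ^ (p + 2)), c, fun p => ?_, hc, ?_⟩
  · have : 0 < max p 1 := lt_max_of_lt_right one_pos
    positivity
  intro P _ δ hδ1 hδ2 hσ hI
  have hQ := BlockMeans.isStandard_standardLaw hσ
  have hQI := BlockMeans.integrable_standardLaw_rpow hσ hI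
  have hz := BlockMeans.half_le_setIntegral_standardLaw hσ
  refine ⟨BlockMeans.biasRate (BlockMeans.standardLaw P) (c (BlockMeans.zeta P)),
    fun hδ => BlockMeans.isLittleO_biasRate (hc _) hδ1 hδ hQI, ?_, ?_⟩
  · rintro rfl
    exact BlockMeans.isBigO_biasRate (hc _) hQI
  intro p hp N k n hk hn G hG Ω _ Pr _ X hX hind s hs
  have hn0 : 0 < n := by omega
  have hbad := hcQ (BlockMeans.zeta P) (BlockMeans.standardLaw P) hQ hz n hn
  set μ := BlockMeans.mean P with hμ
  set σ := BlockMeans.sd P with hσdef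
  set Z : Fin k × Fin n → Ω → ℝ := fun q ω => (X (hG.index q) ω - μ) / σ with hZdef
  have hZ : ∀ q, HasLaw (Z q) (BlockMeans.standardLaw P) Pr := fun q => by
    have hmeas := (hX (hG.index q)).aemeasurable
    refine ⟨by fun_prop, ?_⟩
    rw [BlockMeans.standardLaw, ← (hX (hG.index q)).map_eq,
      AEMeasurable.map_map_of_aemeasurable (by fun_prop) hmeas, (hX (hG.index q)).map_eq]
    rfl
  have hZind : iIndepFun Z Pr :=
    (hind.precomp hG.index_injective).comp (fun _ x => (x - μ) / σ) fun _ => by fun_prop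
  have hle := hQ.measureReal_blocks_le hk hn0 hp hs hbad hZ hZind
  have hbias := hQ.abs_integral_score_le hp hn0 hbad
  simp only [max_eq_left hp]
  set S := {ω | BlockMeans.HarmonicMeanEvent σ p G (fun i => X i ω) →
    (∀ j, 0 < BlockMeans.blockSd (fun i => X i ω) (G j)) ∧
      |BlockMeans.estimator p G (fun i => X i ω) - μ| ≤ 4 ^ p * (p * 11 ^ (p + 2)) * σ *
        (√((s + 1) / N) + BlockMeans.biasRate (BlockMeans.standardLaw P)
          (c (BlockMeans.zeta P)) n)} with hS
  set B := {ω | √(2 * k * (4 * (61 * (11 ^ p) ^ 2 / n)) * s) ≤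
        |∑ j, (BlockMeans.score p (fun i => Z (j, i) ω) - ∫ y, BlockMeans.score p y
          ∂(Measure.pi fun _ : Fin n => BlockMeans.standardLaw P))|} ∪
      ⋃ j, {ω | ¬ BlockMeans.IsGood fun i => Z (j, i) ω} with hB
  -- Covering the whole space and using subadditivity bounds the probability of `S` from below
  -- without its measurability.
  have hcov : Set.univ ⊆ S ∪ B := by
    intro ω _
    by_cases hω : ω ∈ B
    · exact Or.inr hω
    left
    simp only [hB, Set.mem_union, Set.mem_iUnion, Set.mem_ofPred_eq, not_or, not_le, not_exists,
      not_not] at hω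
    obtain ⟨hdev, hgood⟩ := hω
    have hsd := hG.blockSd_eq hn0 hσ (μ := μ) (fun i => X i ω)
    intro hH
    refine ⟨fun j => ?_, ?_⟩
    · rw [hsd j]
      exact mul_pos hσ (lt_of_lt_of_le (by norm_num) (hgood j).1)
    · exact BlockMeans.abs_estimator_sub_le hk hn0 hG.card_eq hp hσ hgood hsd
        (hG.blockMean_eq hn0 hσ (μ := μ) fun i => X i ω) hH hs hbias hdev.le
  have h1 : Pr.real Set.univ ≤ Pr.real S + Pr.real B :=
    (measureReal_mono hcov).trans (measureReal_union_le _ _)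
  rw [probReal_univ] at h1
  linarith
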